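/- Let $X$ be a finite $T_0$ topological space, with the partial order $p\le q \iff \overline{\{p\}}\subseteq\overline{\{q\}}$, and let $n=\dim X$ be the maximal length of a chain $x_0<\dots<x_n$ in $X$. For $x\in X$ let $U_x=\{q\in X: q\ge x\}$ be the smallest open subset containing $x$. An abelian data on $X$ is a functor $F$ from the poset $X$ to abelian groups, $p\mapsto F_p$; for $U\subseteq X$ open, $\mathbb{Z}_U$ denotes the abelian data which is the constant one $\mathbb{Z}$ on $U$ and zero outside $U$. Let $D(X)$ be the (unbounded) derived category of abelian data on $X$. Then the total left derived functor $\mathbb{L}(X,-)\colon D(X)\to D(\mathrm{Ab})$ of the cosections functor $L(X,F)=\varinjlim_{x\in X}F_x$ exists. A codualizing complex of $X$ is an object $D^X$ of $D(X)$ which is the value at $\mathbb{Z}$ of the left adjoint of $\mathbb{L}(X,-)$, i.e. for which there are bijections $$\operatorname{Hom}_{D(X)}(D^X,F)\simeq \operatorname{Hom}_{D(\mathrm{Ab})}(\mathbb{Z},\mathbb{L}(X,F)),$$ natural in $F\in D(X)$. Theorem. The codualizing complex $D^X$ exists and is isomorphic, in $D(X)$, to a complex of abelian data $$0\to (D^X)^0\to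 (D^X)^1\to\cdots\to (D^X)^n\to 0$$ which is zero outside the degrees $0,\dots,n$ (and zero altogether if $X$ is empty), and whose term of degree $i\ge 0$ is $$(D^X)^i\simeq\bigoplus_{x_0<\cdots<x_i}\mathbb{Z}_{U_{x_0}},$$ the sum being over all strict chains $x_0<\cdots<x_i$ of points of $X$. In particular, $D^X$ is of finite type: for all $i\in\mathbb{Z}$ and all $x\in X$, the abelian group $H^i(D^X)_x$ is finitely generated. -/

import Mathlib

open CategoryTheory CategoryTheory.Limits TopologicalSpace

universe u

noncomputable section

namespace FiniteSpace

/-- Abelian data on a space `X`: functors to abelian groups from `X`, viewed as a category through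
its preorder `p ≤ q ↔ closure {p} ⊆ closure {q}`, which is the one that Mathlib puts on
`Specialization X`, a copy of the type `X`. -/
abbrev AbData (X : Type u) [TopologicalSpace X] : Type (u + 1) :=
  Specialization X ⥤ AddCommGrpCat.{u}

/-- The group `ℤ`, in the universe `u`. -/
abbrev intGrp : AddCommGrpCat.{u} := AddCommGrpCat.of (ULift.{u} ℤ)

section

variable {X : Type u} [TopologicalSpace X]

/-- The subgroup `(F_U)_p` of `F_p`: all of `F_p` if `p ∈ U`, and zero if `p ∉ U`. -/
def supportedSubgroup (F : AbData X) (U : Opens X) (p : Specialization X) :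
    AddSubgroup (F.obj p) where
  carrier := {s | Specialization.ofEquiv p ∉ U → s = 0}
  zero_mem' := fun _ => rfl
  add_mem' := fun ha hb hp => by rw [ha hp, hb hp, add_zero]
  neg_mem' := fun ha hp => by rw [ha hp, neg_zero]

theorem supportedSubgroup_map (F : AbData X) (U : Opens X) {p q : Specialization X} (h : p ⟶ q)
    {s : F.obj p} (hs : s ∈ supportedSubgroup F U p) :
    (F.map h).hom s ∈ supportedSubgroup F U q := by
  intro hq
  have hp : Specialization.ofEquiv p ∉ U := fun hp =>
    hq ((Specialization.ofEquiv_specializes_ofEquiv.2 (leOfHom h)).mem_open U.isOpen hp)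
  rw [hs hp, map_zero]

/-- The abelian data `F_U` for an open subset `U`: `F` on `U` and zero outside of `U`, with the
restriction morphisms of `F` between points of `U`. -/
def supportOn (F : AbData X) (U : Opens X) : AbData X where
  obj p := AddCommGrpCat.of (supportedSubgroup F U p)
  map {p q} h := AddCommGrpCat.ofHom
    (((F.map h).hom.comp (supportedSubgroup F U p).subtype).codRestrict
      (supportedSubgroup F U q) fun s => supportedSubgroup_map F U h s.2)
  map_id p := by
    ext s
    simp
  map_comp f g := by
    ext s
    simp

/-- The constant abelian data `ℤ` on `X`. -/
def constInt (X : Type u) [TopologicalSpace X] : AbData X :=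
  (Functor.const (Specialization X)).obj intGrp

/-- The smallest open subset `U_x` containing the point `x` of a finite space. -/
def minOpen [Finite X] (x : X) : Opens X := ⟨nhdsKer {x}, isOpen_nhdsKer⟩

/-- The strict chains `x_0 < ⋯ < x_i` of points of `X`. -/
abbrev StrictChain (X : Type u) [TopologicalSpace X] (i : ℕ) : Type u :=
  {c : Fin (i + 1) → Specialization X // StrictMono c}

/-- The direct sum, over the chains `x_0 < ⋯ < x_i` of `X`, of the abelian data `ℤ_{U_{x_0}}`. -/
def chainSum (X : Type u) [TopologicalSpace X] [Finite X] (i : ℕ) : AbData X :=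
  ∐ fun c : StrictChain X i =>
    supportOn (constInt X) (minOpen (Specialization.ofEquiv (c.1 0)))

end

variable (X : Type u) [TopologicalSpace X]

/-- The dimension of a finite space: the supremum of the lengths `n` of the chains
`x_0 < ⋯ < x_n` (it is `⊥` for the empty space). -/
def dim : WithBot ℕ∞ := Order.krullDim (Specialization X)

/-- The cosections functor `F ↦ L(X, F) = colim_{x ∈ X} F_x`. -/
def cosections : AbData X ⥤ AddCommGrpCat.{u} := colim

instance : (cosections X).PreservesZeroMorphisms :=
  inferInstanceAs (colim : AbData X ⥤ AddCommGrpCat.{u}).PreservesZeroMorphisms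

variable [HasDerivedCategory.{u + 1} (AbData X)] [HasDerivedCategory.{u + 1} AddCommGrpCat.{u}]

/-- The functor `L(X, -)`, applied in each degree to complexes of abelian data, with values in the
derived category of abelian groups. -/
def cosectionsToDerived : CochainComplex (AbData X) ℤ ⥤ DerivedCategory AddCommGrpCat.{u} :=
  (cosections X).mapHomologicalComplex (ComplexShape.up ℤ) ⋙ DerivedCategory.Q

/-- The total left derived functor of `L(X, -)` exists. -/
abbrev HasDerivedCosections : Prop :=
  (cosectionsToDerived X).HasLeftDerivedFunctor
    (HomologicalComplex.quasiIso (AbData X) (ComplexShape.up ℤ))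

/-- The total left derived functor `𝕃(X, -) : D(X) ⥤ D(Ab)` of the cosections functor, on
unbounded derived categories. -/
def derivedCosections [HasDerivedCosections X] :
    DerivedCategory (AbData X) ⥤ DerivedCategory AddCommGrpCat.{u} :=
  (cosectionsToDerived X).totalLeftDerived DerivedCategory.Q
    (HomologicalComplex.quasiIso (AbData X) (ComplexShape.up ℤ))

/-- An object `D` of `D(X)` is a codualizing complex of `X` if it is the value at `ℤ` of the left
adjoint of `𝕃(X, -)`, that is, if there are bijections `Hom(D, F) ≃ Hom(ℤ, 𝕃(X, F))`, natural in
the object `F` of `D(X)`. -/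
def IsCodualizing [HasDerivedCosections X] (D : DerivedCategory (AbData X)) : Prop :=
  Nonempty ((derivedCosections X ⋙ coyoneda.obj
    (Opposite.op ((DerivedCategory.singleFunctor AddCommGrpCat.{u} 0).obj intGrp))).CorepresentableBy
      D)

variable {X}

/-- An object `D` of `D(X)` is of finite type if `H^i(D)_x` is a finitely generated abelian group
for all `i` and all `x`. -/
def IsFiniteType (D : DerivedCategory (AbData X)) : Prop :=
  ∀ (i : ℤ) (x : Specialization X),
    AddGroup.FG (((DerivedCategory.homologyFunctor (AbData X) i).obj D).obj x)

end FiniteSpace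

end

/-! For abelian data $F$ put $(BF)_y=\bigoplus_{x\le y}F_x$, with the augmentation $BF\to F$ adding
up the images in $F_y$, and let $KF$ be its kernel. Then $B$ is exact, and so is $\varinjlim
BF=\bigoplus_xF_x$. A syzygy at $y$ is determined by its components at the points $x<y$, which are
arbitrary, so $(KF)_y\cong\bigoplus_{x<y}F_x$. Hence each application of $K$ kills one more layer of
points, and $K^m=0$ for $m=|X|$ (`FinitePoset.vanishes`).

Because syzygies vanish after finitely many steps, unbounded complexes need no special care: the
iterated cones $R_{m+1}Y=\mathrm{cone}(R_m(KY)\to BY)$ resolve $Y$ functorially by complexes on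
which the colimit preserves quasi-isomorphisms (`CIsSplit.quasiIso_map`). By
`isLeftDerivedFunctor_of_deformation`, $\varinjlim R_mY$ computes $\mathbb L(X,Y)$.

Since $\operatorname{Hom}(\mathbb Z_{U_x},F)=F_x$, the sum $D_i$ over the chains of length $i$
satisfies $\operatorname{Hom}(D_0,F)=\operatorname{Hom}(\mathbb Z,\varinjlim BF)$ and
$\operatorname{Hom}(D_{i+1},F)=\operatorname{Hom}(D_i,KF)$: removing the first point of a chain is
the description of $(KF)_{x_1}$ above. Yoneda then gives the differentials of $D$, and chain maps
$D\to Y$ are exactly the degree $0$ cocycles of $\varinjlim R_mY$ (`toΦ_d`, `toΦ_injective`,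
`toΦ_surjective`). As $\mathbb Z$ is projective, this bijection descends to derived categories
(`universalClass_bijective`). Finite type holds because the terms of $D$ have finitely generated
stalks. -/

noncomputable section

universe v₁ v₂ u₁ u₂ w₁ w₂

/-! ### Left derived functors from functorial resolutions -/

namespace CategoryTheory.Functor

/-- If `R` is a functorial resolution such that `R ⋙ F` factors through the localization `Q` and
`F` inverts `R.obj (R.obj X) ⟶ R.obj X`, then the functor induced by `R ⋙ F` is a left derived
functor of `F`. -/
theorem isLeftDerivedFunctor_of_deformation {C D H : Type*} [Category C] [Category D] [Category H]
    (F : C ⥤ H) (W : MorphismProperty C) (Q : C ⥤ D) [Q.IsLocalization W]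
    (R : C ⥤ C) (ρ : R ⟶ 𝟭 C) (hρ : ∀ X, W (ρ.app X))
    (hF : ∀ X, IsIso (F.map (ρ.app (R.obj X))))
    (G : D ⥤ H) (e : Q ⋙ G ≅ R ⋙ F) :
    G.IsLeftDerivedFunctor (e.hom ≫ whiskerRight ρ F ≫ F.leftUnitor.hom) W := by
  have hQ : ∀ X, IsIso (Q.map (ρ.app X)) := fun X => Localization.inverts Q W _ (hρ X)
  let r : R ⋙ Q ≅ Q := NatIso.ofComponents (fun X => asIso (Q.map (ρ.app X))) (by
    intro X Y f
    have := ρ.naturality f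
    dsimp at this ⊢
    rw [← Q.map_comp, this, Q.map_comp])
  have hr : ∀ X, r.hom.app X = Q.map (ρ.app X) := fun X => rfl
  -- Uniqueness: it suffices to compare at the objects `R.obj X`, to which every `X` is linked by an
  -- isomorphism after `Q`; there the counit of `G` is invertible and can be cancelled.
  have huniq (E : D ⥤ H) (γ₁ γ₂ : E ⟶ G)
      (h : ∀ X, γ₁.app (Q.obj X) ≫ e.hom.app X ≫ F.map (ρ.app X) =
        γ₂.app (Q.obj X) ≫ e.hom.app X ≫ F.map (ρ.app X)) : γ₁ = γ₂ := by
    refine Localization.natTrans_ext Q W fun X => ?_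
    have hX := h (R.obj X)
    have := hF X
    rw [← Category.assoc, ← Category.assoc, cancel_mono, cancel_mono] at hX
    rw [← cancel_epi (E.map (Q.map (ρ.app X)))]
    simp [hX]
  refine ⟨⟨⟨Limits.IsTerminal.ofUniqueHom (fun E => ?_) ?_⟩⟩⟩
  · let β : Q ⋙ E.left ⟶ F := E.hom
    -- Existence: move from `X` back to `R.obj X` along the inverse of `Q.map (ρ.app X)`, then apply
    -- the given transformation there and identify its target with the value of `G`.
    let τ : Q ⋙ E.left ⟶ Q ⋙ G :=
      { app := fun X => E.left.map (r.inv.app X) ≫ β.app (R.obj X) ≫ e.inv.app X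
        naturality := by
          intro X Y f
          have h1 := β.naturality (R.map f)
          have h2 := e.inv.naturality f
          have h3 := r.inv.naturality f
          dsimp at h1 h2 h3 ⊢
          rw [← E.left.map_comp_assoc, h3, E.left.map_comp_assoc, reassoc_of% h1, h2]
          simp }
    refine CostructuredArrow.homMk
      (Localization.liftNatTrans Q W (Q ⋙ E.left) (Q ⋙ G) E.left G τ) ?_
    ext X
    have h := β.naturality (ρ.app X)
    dsimp at h
    simp only [RightExtension.mk, whiskeringLeft_obj_obj, whiskeringLeft_obj_map,
      CostructuredArrow.mk_hom_eq_self, NatTrans.comp_app, whiskerLeft_app,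
      Localization.liftNatTrans_app, whiskerRight_app, leftUnitor_hom_app, τ,
      Localization.Lifting.iso, Iso.refl_hom, NatTrans.id_app, Category.comp_id,
      Category.assoc, Iso.refl_inv, comp_obj, id_obj, CostructuredArrow.mk_left, Category.id_comp,
      Iso.inv_hom_id_app_assoc]
    rw [← h, ← hr, ← E.left.map_comp_assoc]
    simp [β]
  · intro E m
    ext1
    refine huniq E.left _ _ fun X => ?_
    have h (m : E ⟶ RightExtension.mk G (e.hom ≫ whiskerRight ρ F ≫ F.leftUnitor.hom)) :
        m.left.app (Q.obj X) ≫ e.hom.app X ≫ F.map (ρ.app X) = E.hom.app X := by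
      have := NatTrans.congr_app (CostructuredArrow.w m) X
      simpa [RightExtension.mk] using this
    exact (h m).trans (h _).symm

end CategoryTheory.Functor

/-! ### Acyclic complexes and mapping cones -/

namespace CategoryTheory

open CochainComplex

theorem quasiIso_of_acyclic {A : Type u₁} [Category.{v₁} A] [Abelian A] {Y Z : CochainComplex A ℤ}
    (f : Y ⟶ Z) (hY : Y.Acyclic) (hZ : Z.Acyclic) : QuasiIso f where
  quasiIsoAt i := (quasiIsoAt_iff_exactAt f i (hY i)).2 (hZ i)

theorem quasiIso_iff_acyclic_mappingCone {A : Type u₁} [Category.{v₁} A] [Abelian A]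
    {Y Z : CochainComplex A ℤ} (f : Y ⟶ Z) : QuasiIso f ↔ (mappingCone f).Acyclic := by
  rw [← HomologicalComplex.mem_quasiIso_iff, ← HomotopyCategory.quotient_map_mem_quasiIso_iff,
    HomotopyCategory.quasiIso_eq_trW_subcategoryAcyclic,
    ← HomotopyCategory.quotient_obj_mem_subcategoryAcyclic_iff_acyclic]
  exact ObjectProperty.trW_iff_of_distinguished _ _
    (HomotopyCategory.mappingCone_triangleh_distinguished f)

section

variable {A : Type u₁} [Category.{v₁} A] [Abelian A] {K₁ L₁ K₂ L₂ : CochainComplex A ℤ}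
  (φ₁ : K₁ ⟶ L₁) (φ₂ : K₂ ⟶ L₂) (a : K₁ ⟶ K₂) (b : L₁ ⟶ L₂) (comm : φ₁ ≫ b = a ≫ φ₂)

theorem mappingCone_inl_v_map_f (p q : ℤ) (h : p + -1 = q) :
    (mappingCone.inl φ₁).v p q h ≫ (mappingCone.map φ₁ φ₂ a b comm).f q =
      a.f p ≫ (mappingCone.inl φ₂).v p q h := by
  simp [mappingCone.map]

theorem mappingCone_inr_f_map_f (p : ℤ) :
    (mappingCone.inr φ₁).f p ≫ (mappingCone.map φ₁ φ₂ a b comm).f p =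
      b.f p ≫ (mappingCone.inr φ₂).f p := by
  simp [mappingCone.map]

end

/-! ### Syzygies and complexes with split terms -/

/-- Functors `K ⟶ B ⟶ 𝟭` on an abelian category, forming a short exact sequence, with `B` and
`B ⋙ L` exact, such that `B.obj F ⟶ F` splits if `F` is itself a value of `B`. -/
structure BarData {A : Type u₁} [Category.{v₁} A] [Abelian A] {C : Type u₂} [Category.{v₂} C]
    [Abelian C] (L : A ⥤ C) [L.Additive] where
  /-- the functor whose values are acyclic for `L` -/
  B : A ⥤ A
  /-- the functor of syzygies -/
  K : A ⥤ A
  [additive_B : B.Additive]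
  [additive_K : K.Additive]
  /-- the inclusion of the syzygies -/
  ι : K ⟶ B
  /-- the augmentation -/
  ε : B ⟶ 𝟭 A
  zero (F : A) : ι.app F ≫ ε.app F = 0
  shortExact (F : A) : (ShortComplex.mk _ _ (zero F)).ShortExact
  /-- the comultiplication -/
  σ (F : A) : B.obj F ⟶ B.obj (B.obj F)
  σ_ε (F : A) : σ F ≫ ε.app (B.obj F) = 𝟙 _
  preservesHomology_B : B.PreservesHomology
  preservesHomology_L : (B ⋙ L).PreservesHomology

namespace BarData

variable {A : Type u₁} [Category.{v₁} A] [Abelian A] {C : Type u₂} [Category.{v₂} C]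
    [Abelian C] {L : A ⥤ C} [L.Additive] (β : BarData L)

instance : β.B.Additive := β.additive_B
instance : β.K.Additive := β.additive_K
instance : β.B.PreservesHomology := β.preservesHomology_B
instance : (β.B ⋙ L).PreservesHomology := β.preservesHomology_L

/-- `B`, in each degree of a complex. -/
abbrev cB : CochainComplex A ℤ ⥤ CochainComplex A ℤ :=
  β.B.mapHomologicalComplex (ComplexShape.up ℤ)

/-- `K`, in each degree of a complex. -/
abbrev cK : CochainComplex A ℤ ⥤ CochainComplex A ℤ :=
  β.K.mapHomologicalComplex (ComplexShape.up ℤ)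

/-- The inclusion of the syzygies, in each degree of a complex. -/
def cι : β.cK ⟶ β.cB := NatTrans.mapHomologicalComplex β.ι _

/-- The augmentation, in each degree of a complex. -/
@[simps]
def cε : β.cB ⟶ 𝟭 (CochainComplex A ℤ) where
  app Y := { f := fun i => β.ε.app (Y.X i), comm' := fun i j _ => (β.ε.naturality (Y.d i j)).symm }
  naturality Y Z f := by
    ext i
    exact β.ε.naturality (f.f i)

@[simp]
theorem cι_cε (Y : CochainComplex A ℤ) : β.cι.app Y ≫ β.cε.app Y = 0 := by
  ext i
  exact β.zero (Y.X i)

/-- The short exact sequence of complexes given by the syzygies and the augmentation. -/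
abbrev cShort (Y : CochainComplex A ℤ) : ShortComplex (CochainComplex A ℤ) :=
  ShortComplex.mk (X₃ := Y) (β.cι.app Y) (β.cε.app Y) (β.cι_cε Y)

theorem cShort_shortExact (Y : CochainComplex A ℤ) : (β.cShort Y).ShortExact :=
  HomologicalComplex.shortExact_of_degreewise_shortExact _ fun i => β.shortExact (Y.X i)

/-- The objects `F` such that `B.obj F ⟶ F` splits. -/
def IsSplit (F : A) : Prop := ∃ s : F ⟶ β.B.obj F, s ≫ β.ε.app F = 𝟙 F

variable {β} in
theorem IsSplit.of_retract {F G : A} (hG : β.IsSplit G) (i : F ⟶ G) (r : G ⟶ F) (h : i ≫ r = 𝟙 F) :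
    β.IsSplit F := by
  obtain ⟨s, hs⟩ := hG
  refine ⟨i ≫ s ≫ β.B.map r, ?_⟩
  have := β.ε.naturality r
  dsimp at this
  rw [Category.assoc, Category.assoc, this, reassoc_of% hs, h]

theorem isSplit_B (F : A) : β.IsSplit (β.B.obj F) := ⟨β.σ F, β.σ_ε F⟩

variable {β} in
/-- A splitting of the short exact sequence of syzygies of a split object. -/
def splitting {F : A} (hF : β.IsSplit F) : (ShortComplex.mk _ _ (β.zero F)).Splitting :=
  have := (β.shortExact F).mono_f
  ShortComplex.Splitting.ofExactOfSection _ (β.shortExact F).exact hF.choose hF.choose_spec this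

-- The splitting exhibits the syzygies as a retract of a value of `B`, and those are split by the
-- comultiplication.
variable {β} in
theorem IsSplit.K {F : A} (hF : β.IsSplit F) : β.IsSplit (β.K.obj F) :=
  (β.isSplit_B F).of_retract (β.ι.app F) (splitting hF).r (splitting hF).f_r

/-- The complexes which are split in each degree. -/
def CIsSplit (Y : CochainComplex A ℤ) : Prop := ∀ i, β.IsSplit (Y.X i)

theorem cIsSplit_cB (Y : CochainComplex A ℤ) : β.CIsSplit (β.cB.obj Y) := fun i =>
  β.isSplit_B (Y.X i)

variable {β} in
theorem CIsSplit.mappingCone {Y Z : CochainComplex A ℤ} (φ : Y ⟶ Z) (hY : β.CIsSplit Y)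
    (hZ : β.CIsSplit Z) : β.CIsSplit (mappingCone φ) := by
  intro i
  obtain ⟨s, hs⟩ := hY (i + 1)
  obtain ⟨t, ht⟩ := hZ i
  refine ⟨(mappingCone.fst φ).1.v i (i + 1) rfl ≫ s ≫
    β.B.map ((mappingCone.inl φ).v (i + 1) i (by lia)) +
    (mappingCone.snd φ).v i i (add_zero i) ≫ t ≫ β.B.map ((mappingCone.inr φ).f i), ?_⟩
  have h₁ := β.ε.naturality ((mappingCone.inl φ).v (i + 1) i (by lia))
  have h₂ := β.ε.naturality ((mappingCone.inr φ).f i)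
  dsimp at h₁ h₂
  simp only [Preadditive.add_comp, Category.assoc, h₁, h₂, reassoc_of% hs, reassoc_of% ht]
  simp [mappingCone.ext_from_iff _ _ _ rfl]

/-- The `m`-th syzygies of the object vanish. -/
def Vanishes : ℕ → A → Prop
  | 0, F => IsZero F
  | m + 1, F => Vanishes m (β.K.obj F)

-- Dimension shifting along $0\to KY\to BY\to Y\to 0$. The sequence splits in each degree, so `L`
-- keeps it short exact; $L(BY)$ is acyclic because `B ⋙ L` is exact, and $L(KY)$ by induction on
-- the number of syzygies.
variable {β} in
theorem CIsSplit.acyclic_map {m : ℕ} : ∀ {Y : CochainComplex A ℤ}, β.CIsSplit Y →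
    (∀ i, β.Vanishes m (Y.X i)) → Y.Acyclic →
    ((L.mapHomologicalComplex (ComplexShape.up ℤ)).obj Y).Acyclic := by
  induction m with
  | zero =>
    intro Y _ hY _ i
    refine ShortComplex.exact_of_isZero_X₂ _ (L.map_isZero (hY i))
  | succ m ih =>
    intro Y hY hV hA
    have hB : (β.cB.obj Y).Acyclic := fun i => by
      have := (hA i).map β.B
      exact this
    have hE : ((L.mapHomologicalComplex (ComplexShape.up ℤ)).obj (β.cB.obj Y)).Acyclic :=
        fun i => by
      have := (hA i).map (β.B ⋙ L)
      exact this
    have hK : (β.cK.obj Y).Acyclic := by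
      refine (β.cShort_shortExact Y).acyclic_X₁ ?_
      exact quasiIso_of_acyclic _ hB hA
    have h := ih (Y := β.cK.obj Y) (fun i => (hY i).K) hV hK
    have hS : ((β.cShort Y).map (L.mapHomologicalComplex (ComplexShape.up ℤ))).ShortExact :=
      HomologicalComplex.shortExact_of_degreewise_shortExact _ fun i =>
        ((splitting (hY i)).map L).shortExact
    exact hS.acyclic_X₃ (quasiIso_of_acyclic _ h hE)

-- Apply the acyclicity result to the cone, whose terms are still split and whose formation commutes
-- with `L`.
variable {β} in
theorem CIsSplit.quasiIso_map {m : ℕ} {Y Z : CochainComplex A ℤ} (φ : Y ⟶ Z) (hY : β.CIsSplit Y)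
    (hZ : β.CIsSplit Z) (hm : ∀ F, β.Vanishes m F) [QuasiIso φ] :
    QuasiIso ((L.mapHomologicalComplex (ComplexShape.up ℤ)).map φ) := by
  rw [quasiIso_iff_acyclic_mappingCone]
  have h := (hY.mappingCone φ hZ).acyclic_map (m := m) (fun i => hm _)
    ((quasiIso_iff_acyclic_mappingCone φ).1 inferInstance)
  exact fun i => (h i).of_iso (mappingCone.mapHomologicalComplexIso φ L)

/-! ### Functorial resolutions by iterated cones -/

section Resolution

variable {R : CochainComplex A ℤ ⥤ CochainComplex A ℤ} (ρ : R ⟶ 𝟭 _)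

/-- The morphism `R (K Y) ⟶ K Y ⟶ B Y`. -/
def toB (Y : CochainComplex A ℤ) : R.obj (β.cK.obj Y) ⟶ β.cB.obj Y :=
  ρ.app (β.cK.obj Y) ≫ β.cι.app Y

theorem toB_naturality {Y Z : CochainComplex A ℤ} (f : Y ⟶ Z) :
    β.toB ρ Y ≫ β.cB.map f = R.map (β.cK.map f) ≫ β.toB ρ Z := by
  have h₁ := ρ.naturality (β.cK.map f)
  have h₂ := β.cι.naturality f
  dsimp only [Functor.id_map] at h₁
  rw [toB, toB, Category.assoc, ← h₂, reassoc_of% h₁]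

/-- The functor `Y ↦ cone (R (K Y) ⟶ B Y)`. -/
@[simps]
def coneFunctor : CochainComplex A ℤ ⥤ CochainComplex A ℤ where
  obj Y := mappingCone (β.toB ρ Y)
  map f := mappingCone.map _ _ (R.map (β.cK.map f)) (β.cB.map f) (β.toB_naturality ρ f)
  map_id Y := by
    simp only [CategoryTheory.Functor.map_id]
    exact mappingCone.map_id _
  map_comp f g := by
    simp only [CategoryTheory.Functor.map_comp]
    exact mappingCone.map_comp _ _ _ _ _ _ _ _ _

/-- The projection of `cone (R (K Y) ⟶ B Y)` to `Y`. -/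
def coneDesc (Y : CochainComplex A ℤ) : mappingCone (β.toB ρ Y) ⟶ Y :=
  mappingCone.desc (K := Y) _ 0 (β.cε.app Y) (by simp [toB])

@[simp]
theorem inl_v_coneDesc_f (Y : CochainComplex A ℤ) (p q : ℤ) (h : p + -1 = q) :
    (mappingCone.inl (β.toB ρ Y)).v p q h ≫ (β.coneDesc ρ Y).f q = 0 := by
  simp [coneDesc]

@[simp]
theorem inr_f_coneDesc_f (Y : CochainComplex A ℤ) (p : ℤ) :
    (mappingCone.inr (β.toB ρ Y)).f p ≫ (β.coneDesc ρ Y).f p =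
      (β.cε.app Y).f p :=
  mappingCone.inr_f_desc_f _ _ _ _ _

theorem coneDesc_naturality {Y Z : CochainComplex A ℤ} (f : Y ⟶ Z) :
    mappingCone.map _ _ (R.map (β.cK.map f)) (β.cB.map f) (β.toB_naturality ρ f) ≫
      β.coneDesc ρ Z = β.coneDesc ρ Y ≫ f := by
  ext i
  refine mappingCone.ext_from _ (i + 1) i rfl ?_ ?_
  · simp [reassoc_of% mappingCone_inl_v_map_f, reassoc_of% β.inl_v_coneDesc_f]
  · rw [HomologicalComplex.comp_f, HomologicalComplex.comp_f, reassoc_of% mappingCone_inr_f_map_f,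
      inr_f_coneDesc_f, reassoc_of% inr_f_coneDesc_f]
    exact congr_arg (fun f => HomologicalComplex.Hom.f f i) (β.cε.naturality f)

/-- The natural projection of `cone (R (K Y) ⟶ B Y)` to `Y`. -/
def coneπ : β.coneFunctor ρ ⟶ 𝟭 _ where
  app Y := β.coneDesc ρ Y
  naturality _ _ f := β.coneDesc_naturality ρ f

/-- The projection factors as $\mathrm{cone}(R(KY)\to BY)\to\mathrm{cone}(KY\to BY)\to Y$. The first
map is a quasi-isomorphism by comparing distinguished triangles, the second because $0\to KY\to
BY\to Y\to0$ is exact. -/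
theorem quasiIso_coneDesc (h : ∀ Y, QuasiIso (ρ.app Y)) (Y : CochainComplex A ℤ) :
    QuasiIso (β.coneDesc ρ Y) := by
  let := HasDerivedCategory.standard A
  have := h (β.cK.obj Y)
  have comm : β.toB ρ Y ≫ 𝟙 _ = ρ.app (β.cK.obj Y) ≫ β.cι.app Y := by simp [toB]
  have e : mappingCone.map (β.toB ρ Y) (β.cι.app Y) (ρ.app (β.cK.obj Y)) (𝟙 _) comm ≫
      mappingCone.descShortComplex (β.cShort Y) = β.coneDesc ρ Y := by
    ext i
    refine mappingCone.ext_from _ (i + 1) i rfl ?_ ?_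
    · rw [HomologicalComplex.comp_f, reassoc_of% mappingCone_inl_v_map_f, inl_v_coneDesc_f]
      exact (congrArg _ (mappingCone.inl_v_descShortComplex_f (β.cShort Y) _ _ _)).trans comp_zero
    · rw [HomologicalComplex.comp_f, reassoc_of% mappingCone_inr_f_map_f, inr_f_coneDesc_f]
      exact (Category.id_comp _).trans (mappingCone.inr_f_descShortComplex_f (β.cShort Y) i)
  have h₁ := mappingCone.quasiIso_descShortComplex (β.cShort_shortExact Y)
  have h₂ : QuasiIso (mappingCone.map (β.toB ρ Y) (β.cι.app Y) (ρ.app (β.cK.obj Y)) (𝟙 _)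
      comm) := by
    rw [← DerivedCategory.isIso_Q_map_iff_quasiIso]
    exact Pretriangulated.isIso₃_of_isIso₁₂ (DerivedCategory.Q.mapTriangle.map
      (mappingCone.triangleMap _ _ (ρ.app (β.cK.obj Y)) (𝟙 (β.cB.obj Y)) comm))
      (DerivedCategory.mappingCone_triangle_distinguished _)
      (DerivedCategory.mappingCone_triangle_distinguished _)
      (inferInstanceAs (IsIso (DerivedCategory.Q.map (ρ.app (β.cK.obj Y)))))
      (inferInstanceAs (IsIso (DerivedCategory.Q.map (𝟙 (β.cB.obj Y)))))
  rw [← e]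
  exact quasiIso_comp _ _

end Resolution

/-- The iterated resolutions, as endofunctors augmented to the identity. -/
def res : ℕ → Over (𝟭 (CochainComplex A ℤ))
  | 0 => Over.mk (𝟙 _)
  | m + 1 => Over.mk (β.coneπ (res m).hom)

/-- The iterated resolution functors. -/
abbrev R (m : ℕ) : CochainComplex A ℤ ⥤ CochainComplex A ℤ := (β.res m).left

/-- The augmentation of the iterated resolutions. -/
abbrev ρ (m : ℕ) : β.R m ⟶ 𝟭 (CochainComplex A ℤ) := (β.res m).hom

theorem quasiIso_ρ (m : ℕ) : ∀ Y, QuasiIso ((β.ρ m).app Y) := by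
  induction m with
  | zero => exact fun Y => inferInstanceAs (QuasiIso (𝟙 Y))
  | succ m ih => exact fun Y => β.quasiIso_coneDesc (β.ρ m) ih Y

theorem cIsSplit_R (m : ℕ) : ∀ Y : CochainComplex A ℤ, (∀ i, β.Vanishes m (Y.X i)) →
    β.CIsSplit ((β.R m).obj Y) := by
  induction m with
  -- The resolution at stage `0` is the identity, which improves nothing; its terms are split here
  -- only because the hypothesis makes them zero.
  | zero => exact fun Y h i => ⟨0, (h i).eq_of_src _ _⟩
  | succ m ih => exact fun Y h => (ih (β.cK.obj Y) h).mappingCone _ (β.cIsSplit_cB Y)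

/-- The resolutions preserve degreewise split epimorphisms. -/
theorem R_map_section (m : ℕ) : ∀ {Y Z : CochainComplex A ℤ} (p : Y ⟶ Z)
    (_ : ∀ i, ∃ s : Z.X i ⟶ Y.X i, s ≫ p.f i = 𝟙 _) (i : ℤ),
    ∃ s : ((β.R m).obj Z).X i ⟶ ((β.R m).obj Y).X i, s ≫ ((β.R m).map p).f i = 𝟙 _ := by
  induction m with
  | zero => exact fun p h => h
  | succ m ih =>
    intro Y Z p h i
    obtain ⟨s, hs⟩ := ih (β.cK.map p) (fun j => by
      obtain ⟨t, ht⟩ := h j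
      exact ⟨β.K.map t, by
        refine (β.K.map_comp _ _).symm.trans ?_
        rw [ht, β.K.map_id]; rfl⟩) (i + 1)
    obtain ⟨t, ht⟩ : ∃ t : (β.cB.obj Z).X i ⟶ (β.cB.obj Y).X i, t ≫ (β.cB.map p).f i = 𝟙 _ := by
      obtain ⟨t, ht⟩ := h i
      refine ⟨β.B.map t, (β.B.map_comp _ _).symm.trans ?_⟩
      rw [ht, β.B.map_id]
      rfl
    refine ⟨(mappingCone.fst (β.toB (β.ρ m) Z)).1.v i (i + 1) rfl ≫ s ≫
      (mappingCone.inl (β.toB (β.ρ m) Y)).v (i + 1) i (by lia) +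
      (mappingCone.snd (β.toB (β.ρ m) Z)).v i i (add_zero i) ≫ t ≫
        (mappingCone.inr (β.toB (β.ρ m) Y)).f i, ?_⟩
    refine (?_ : _ ≫ (mappingCone.map (β.toB (β.ρ m) Y) (β.toB (β.ρ m) Z)
      ((β.R m).map (β.cK.map p)) (β.cB.map p) (β.toB_naturality (β.ρ m) p)).f i = 𝟙 _)
    rw [Preadditive.add_comp, Category.assoc, Category.assoc, Category.assoc, Category.assoc,
      mappingCone_inl_v_map_f, mappingCone_inr_f_map_f, reassoc_of% hs, reassoc_of% ht,
      mappingCone.id_X]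

/-! ### The derived functor computed by the resolutions -/

variable {m : ℕ} (hm : ∀ F, β.Vanishes m F)

/-- The functor on complexes which computes the left derived functor of `L`. -/
abbrev Φ (m : ℕ) : CochainComplex A ℤ ⥤ CochainComplex C ℤ :=
  β.R m ⋙ L.mapHomologicalComplex (ComplexShape.up ℤ)

-- By two out of three, the map between resolutions is a quasi-isomorphism; its source and target
-- have split terms, so `L` preserves this.
include hm in
theorem quasiIso_Φ_map {Y Z : CochainComplex A ℤ} (φ : Y ⟶ Z) [QuasiIso φ] :
    QuasiIso ((β.Φ m).map φ) := by
  have h₁ := β.quasiIso_ρ m Y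
  have h₂ := β.quasiIso_ρ m Z
  have : QuasiIso ((β.R m).map φ) := by
    rw [← quasiIso_iff_comp_right _ ((β.ρ m).app Z)]
    have := (β.ρ m).naturality φ
    dsimp at this
    rw [this]
    exact quasiIso_comp _ _
  exact CIsSplit.quasiIso_map _ (β.cIsSplit_R m Y fun i => hm _)
    (β.cIsSplit_R m Z fun i => hm _) hm

include hm in
theorem quasiIso_map_ρ {Y : CochainComplex A ℤ} (hY : β.CIsSplit Y) :
    QuasiIso ((L.mapHomologicalComplex (ComplexShape.up ℤ)).map ((β.ρ m).app Y)) := by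
  have := β.quasiIso_ρ m Y
  exact CIsSplit.quasiIso_map _ (β.cIsSplit_R m Y fun i => hm _) hY hm

variable [HasDerivedCategory.{w₂} C]

include hm in
theorem isInvertedBy_Φ : (HomologicalComplex.quasiIso A (ComplexShape.up ℤ)).IsInvertedBy
    (β.Φ m ⋙ DerivedCategory.Q) := fun Y Z φ hφ => by
  have : QuasiIso φ := hφ
  have : QuasiIso ((β.Φ m).map φ) := β.quasiIso_Φ_map hm φ
  exact inferInstanceAs (IsIso (DerivedCategory.Q.map ((β.Φ m).map φ)))

variable [HasDerivedCategory.{w₁} A]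

/-- The functor on derived categories that `Φ` induces. -/
def derived : DerivedCategory A ⥤ DerivedCategory C :=
  Localization.lift (β.Φ m ⋙ DerivedCategory.Q) (β.isInvertedBy_Φ hm) DerivedCategory.Q

/-- The functor on derived categories is computed by `Φ`. -/
def derivedIso : DerivedCategory.Q ⋙ β.derived hm ≅ β.Φ m ⋙ DerivedCategory.Q :=
  Localization.fac _ _ _

theorem isLeftDerivedFunctor_derived : (β.derived hm).IsLeftDerivedFunctor
    (((β.derivedIso hm) ≪≫ Functor.associator _ _ _).hom ≫
      Functor.whiskerRight (β.ρ m) (L.mapHomologicalComplex (ComplexShape.up ℤ) ⋙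
        DerivedCategory.Q) ≫ (Functor.leftUnitor _).hom)
    (HomologicalComplex.quasiIso A (ComplexShape.up ℤ)) := by
  refine Functor.isLeftDerivedFunctor_of_deformation _ _ _ _ _ (β.quasiIso_ρ m) (fun Y => ?_) _ _
  have := β.quasiIso_map_ρ hm (β.cIsSplit_R m Y fun i => hm _)
  dsimp only [Functor.comp_map]
  infer_instance

end BarData

open CochainComplex

/-! ### Cocycles of a mapping cone as pairs -/

section Pair

open mappingCone

variable {A : Type u₁} [Category.{v₁} A] [Abelian A] {C : Type u₂} [Category.{v₂} C]
    [Abelian C] (L : A ⥤ C) [L.Additive] {F G : CochainComplex A ℤ} (φ : F ⟶ G) {Z : C} (k : ℤ)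

/-- The generalized element of the cone of `φ` with given components, after applying `L`. -/
def conePair (a : Z ⟶ L.obj (F.X (k + 1))) (b : Z ⟶ L.obj (G.X k)) :
    Z ⟶ L.obj ((mappingCone φ).X k) :=
  a ≫ L.map ((inl φ).v (k + 1) k (by lia)) + b ≫ L.map ((inr φ).f k)

variable (a : Z ⟶ L.obj (F.X (k + 1))) (b : Z ⟶ L.obj (G.X k))

theorem conePair_fst : conePair L φ k a b ≫ L.map ((fst φ).1.v k (k + 1) rfl) = a := by
  simp [conePair, ← L.map_comp]

theorem conePair_snd : conePair L φ k a b ≫ L.map ((snd φ).v k k (add_zero k)) = b := by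
  simp [conePair, ← L.map_comp]

/-- The differential of the cone is $(a,b)\mapsto(-da,\varphi a+db)$; the two hypotheses are the
vanishing of its components. -/
theorem conePair_d (ha : a ≫ L.map (F.d (k + 1) (k + 1 + 1)) = 0)
    (hb : a ≫ L.map (φ.f (k + 1)) + b ≫ L.map (G.d k (k + 1)) = 0) :
    conePair L φ k a b ≫ L.map ((mappingCone φ).d k (k + 1)) = 0 := by
  have h := inl_v_d φ (k + 1) k (k + 1 + 1) (by lia) (by lia)
  rw [conePair, Preadditive.add_comp, Category.assoc, Category.assoc, ← L.map_comp, ← L.map_comp,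
    h, inr_f_d, L.map_sub, L.map_comp, L.map_comp, L.map_comp, Preadditive.comp_sub,
    reassoc_of% ha, zero_comp, sub_zero, ← Category.assoc, ← Category.assoc,
    ← Preadditive.add_comp, hb, zero_comp]

theorem exists_conePair (z : Z ⟶ L.obj ((mappingCone φ).X k))
    (hz : z ≫ L.map ((mappingCone φ).d k (k + 1)) = 0) :
    ∃ (a : Z ⟶ L.obj (F.X (k + 1))) (b : Z ⟶ L.obj (G.X k)), conePair L φ k a b = z ∧
      a ≫ L.map (F.d (k + 1) (k + 1 + 1)) = 0 ∧
      a ≫ L.map (φ.f (k + 1)) + b ≫ L.map (G.d k (k + 1)) = 0 := by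
  refine ⟨z ≫ L.map ((fst φ).1.v k (k + 1) rfl), z ≫ L.map ((snd φ).v k k (add_zero k)), ?_, ?_, ?_⟩
  · rw [conePair, Category.assoc, Category.assoc, ← Preadditive.comp_add, ← L.map_comp,
      ← L.map_comp, ← L.map_add, id_X, L.map_id, Category.comp_id]
  · have h := d_fst_v φ k (k + 1) (k + 1 + 1) rfl rfl
    rw [Category.assoc, ← L.map_comp, ← neg_eq_zero, ← Preadditive.comp_neg, ← L.map_neg,
      ← h, L.map_comp, reassoc_of% hz, zero_comp]
  · have h := d_snd_v φ k (k + 1) rfl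
    rw [Category.assoc, Category.assoc, ← Preadditive.comp_add, ← L.map_comp, ← L.map_comp,
      ← L.map_add, ← h, L.map_comp, reassoc_of% hz, zero_comp]

omit [L.Additive] in
theorem conePair_map {F' G' : CochainComplex A ℤ} (φ' : F' ⟶ G') (s : F ⟶ F') (t : G ⟶ G')
    (comm : φ ≫ t = s ≫ φ') :
    conePair L φ k a b ≫ L.map ((mappingCone.map φ φ' s t comm).f k) =
      conePair L φ' k (a ≫ L.map (s.f (k + 1))) (b ≫ L.map (t.f k)) := by
  simp only [conePair, Preadditive.add_comp, Category.assoc, ← L.map_comp,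
    mappingCone_inl_v_map_f, mappingCone_inr_f_map_f]

end Pair

/-! ### Corepresenting objects and their differentials -/

namespace BarData

variable {A : Type u₁} [Category.{v₁} A] [Abelian A] {C : Type u₂} [Category.{v₂} C]
    [Abelian C] {L : A ⥤ C} [L.Additive] (β : BarData L)

/-- Objects `D i` that corepresent the functors `F ↦ Hom(Z, L (B (K (⋯ (K F)))))`. -/
structure Corepresentation (Z : C) where
  /-- the corepresenting objects -/
  D : ℕ → A
  /-- the bijections in degree `0` -/
  e {F : A} : (D 0 ⟶ F) ≃ (Z ⟶ L.obj (β.B.obj F))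
  e_comp {F G : A} (f : D 0 ⟶ F) (g : F ⟶ G) : e (f ≫ g) = e f ≫ L.map (β.B.map g)
  /-- the bijections between consecutive degrees -/
  κ (i : ℕ) {F : A} : (D (i + 1) ⟶ F) ≃ (D i ⟶ β.K.obj F)
  κ_comp (i : ℕ) {F G : A} (f : D (i + 1) ⟶ F) (g : F ⟶ G) : κ i (f ≫ g) = κ i f ≫ β.K.map g

namespace Corepresentation

variable {β} {Z : C} (c : β.Corepresentation Z)

theorem κ_zero (i : ℕ) (F : A) : c.κ i (0 : c.D (i + 1) ⟶ F) = 0 := by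
  rw [← comp_zero (f := 𝟙 (c.D (i + 1))), c.κ_comp, β.K.map_zero, comp_zero]

theorem e_zero (F : A) : c.e (0 : c.D 0 ⟶ F) = 0 := by
  rw [← comp_zero (f := 𝟙 (c.D 0)), c.e_comp, β.B.map_zero, L.map_zero, comp_zero]

/-- The differentials between the corepresenting objects. -/
def d : ∀ i, c.D i ⟶ c.D (i + 1)
  -- By Yoneda this comes from the natural map $BKF\to KF\to BF$. The minus sign lets the
  -- commutation of a family with differentials become the relation $\varphi a+db=0$ in the cone.
  | 0 => c.e.symm (-c.e (c.κ 0 (𝟙 (c.D 1))) ≫ L.map (β.ε.app _ ≫ β.ι.app _))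
  | i + 1 => (c.κ i).symm (d i ≫ c.κ (i + 1) (𝟙 _))

theorem κ_d (i : ℕ) {F : A} (g : c.D (i + 2) ⟶ F) :
    c.κ i (c.d (i + 1) ≫ g) = c.d i ≫ c.κ (i + 1) g := by
  rw [c.κ_comp, d, Equiv.apply_symm_apply, Category.assoc, ← c.κ_comp, Category.id_comp]

theorem e_d {F : A} (g : c.D 1 ⟶ F) :
    c.e (c.d 0 ≫ g) = -c.e (c.κ 0 g) ≫ L.map (β.ε.app _ ≫ β.ι.app F) := by
  have h₁ := β.ι.naturality g
  have h₂ := β.ε.naturality (β.K.map g)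
  dsimp at h₁ h₂
  rw [c.e_comp, d, Equiv.apply_symm_apply]
  conv_rhs => rw [← Category.id_comp g, c.κ_comp, c.e_comp]
  simp only [Category.assoc, ← L.map_comp, Preadditive.neg_comp, h₁, reassoc_of% h₂]

/-- In the lowest degree the composite corresponds to $BKKF\to KKF\to BKF\to KF\to BF$, whose middle
two arrows compose to zero. The bijections `κ` reduce each higher degree to the preceding one. -/
theorem d_comp_d (i : ℕ) : c.d i ≫ c.d (i + 1) = 0 := by
  induction i with
  | zero =>
    apply c.e.injective
    rw [e_d, ← Category.comp_id (c.d 1), κ_d, e_d, e_zero]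
    have h (F : A) : (β.ε.app _ ≫ β.ι.app (β.K.obj F)) ≫ β.ε.app _ ≫ β.ι.app F = 0 := by
      have := β.zero (β.K.obj F)
      rw [Category.assoc, reassoc_of% this, zero_comp, comp_zero]
    rw [Preadditive.neg_comp, neg_neg, Category.assoc, ← L.map_comp, h, L.map_zero, comp_zero]
  | succ i ih =>
    apply (c.κ i).injective
    rw [κ_d, ← Category.comp_id (c.d (i + 2)), κ_d, reassoc_of% ih, zero_comp, κ_zero]

variable (Y : CochainComplex A ℤ)

/-- The bijection in degree `0`, with values in a term of a complex. -/
def cE (j : ℤ) : (c.D 0 ⟶ Y.X j) ≃ (Z ⟶ L.obj ((β.cB.obj Y).X j)) := c.e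

/-- The bijection between consecutive degrees, with values in a term of a complex. -/
def cΚ (i : ℕ) (j : ℤ) : (c.D (i + 1) ⟶ Y.X j) ≃ (c.D i ⟶ (β.cK.obj Y).X j) := c.κ i

variable {Y}

theorem cE_comp_d {j : ℤ} (f : c.D 0 ⟶ Y.X j) (j' : ℤ) :
    c.cE Y j' (f ≫ Y.d j j') = c.cE Y j f ≫ L.map ((β.cB.obj Y).d j j') :=
  c.e_comp f (Y.d j j')

theorem cΚ_comp_d (i : ℕ) {j : ℤ} (f : c.D (i + 1) ⟶ Y.X j) (j' : ℤ) :
    c.cΚ Y i j' (f ≫ Y.d j j') = c.cΚ Y i j f ≫ (β.cK.obj Y).d j j' :=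
  c.κ_comp i f (Y.d j j')

theorem cE_comp {Y' : CochainComplex A ℤ} {j : ℤ} (f : c.D 0 ⟶ Y.X j) (φ : Y ⟶ Y') :
    c.cE Y' j (f ≫ φ.f j) = c.cE Y j f ≫ L.map ((β.cB.map φ).f j) :=
  c.e_comp f (φ.f j)

theorem cΚ_comp {Y' : CochainComplex A ℤ} (i : ℕ) {j : ℤ} (f : c.D (i + 1) ⟶ Y.X j)
    (φ : Y ⟶ Y') : c.cΚ Y' i j (f ≫ φ.f j) = c.cΚ Y i j f ≫ (β.cK.map φ).f j :=
  c.κ_comp i f (φ.f j)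

theorem cE_d {j : ℤ} (g : c.D 1 ⟶ Y.X j) : c.cE Y j (c.d 0 ≫ g) =
    -c.cE _ j (c.cΚ Y 0 j g) ≫ L.map ((β.cε.app (β.cK.obj Y)).f j ≫ (β.cι.app Y).f j) :=
  c.e_d g

theorem cΚ_d (i : ℕ) {j : ℤ} (g : c.D (i + 2) ⟶ Y.X j) :
    c.cΚ Y i j (c.d (i + 1) ≫ g) = c.d i ≫ c.cΚ Y (i + 1) j g :=
  c.κ_d i g

/-! ### Families of morphisms as cocycles of the resolved complex -/

variable (Y) (k : ℤ)

/-- Morphisms of degree `k` from the complex of the corepresenting objects. -/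
@[ext]
structure Fam where
  /-- the components -/
  f (i : ℕ) (j : ℤ) (h : k + i = j) : c.D i ⟶ Y.X j
  comm (i : ℕ) (j j' : ℤ) (h : k + i = j) (h' : k + (i + 1 : ℕ) = j') :
    f i j h ≫ Y.d j j' = c.d i ≫ f (i + 1) j' h'

namespace Fam

variable {c Y k}

/-- The component in degree `0`. -/
def head (f : c.Fam Y k) : c.D 0 ⟶ Y.X k := f.f 0 k (by simp)

/-- The family of degree `k + 1` into the syzygies. -/
def shift (f : c.Fam Y k) : c.Fam (β.cK.obj Y) (k + 1) where
  f i j h := c.cΚ Y i j (f.f (i + 1) j (by lia))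
  comm i j j' h h' := by
    rw [← cΚ_d, ← f.comm (i + 1) j j' (by lia) (by lia), cΚ_comp_d]

/-- The composition with a morphism of complexes. -/
@[simps]
def map {Y' : CochainComplex A ℤ} (f : c.Fam Y k) (φ : Y ⟶ Y') : c.Fam Y' k where
  f i j h := f.f i j h ≫ φ.f j
  comm i j j' h h' := by
    rw [Category.assoc, φ.comm, reassoc_of% f.comm i j j' h h']

theorem shift_map {Y' : CochainComplex A ℤ} (f : c.Fam Y k) (φ : Y ⟶ Y') :
    (f.map φ).shift = f.shift.map (β.cK.map φ) := by
  ext i j h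
  exact c.cΚ_comp i _ _

/-- The element of the complex `Φ` that corresponds to a family. -/
def toΦ : ∀ (m : ℕ) {Y : CochainComplex A ℤ} {k : ℤ}, c.Fam Y k →
    (Z ⟶ L.obj (((β.R m).obj Y).X k))
  -- A default value: stage `0` is only meaningful for complexes with zero terms, where no other
  -- value exists.
  | 0, _, _, _ => 0
  | m + 1, Y, k, f => conePair L (β.toB (β.ρ m) Y) k (toΦ m f.shift) (c.cE Y k f.head)

theorem toΦ_succ (m : ℕ) (f : c.Fam Y k) : f.toΦ (m + 1) =
    conePair L (β.toB (β.ρ m) Y) k (f.shift.toΦ m) (c.cE Y k f.head) := rfl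

theorem toΦ_map (m : ℕ) : ∀ {Y Y' : CochainComplex A ℤ} {k : ℤ} (f : c.Fam Y k) (φ : Y ⟶ Y'),
    (f.map φ).toΦ m = f.toΦ m ≫ L.map (((β.R m).map φ).f k) := by
  induction m with
  | zero => exact fun f φ => zero_comp.symm
  | succ m ih =>
    intro Y Y' k f φ
    refine Eq.trans ?_ (conePair_map _ _ _ _ _ _ _ _ (β.toB_naturality (β.ρ m) φ)).symm
    rw [toΦ_succ, shift_map, ih, ← cE_comp]
    rfl

theorem toΦ_ρ (m : ℕ) {Y : CochainComplex A ℤ} {k : ℤ} (hY : β.Vanishes m (Y.X k))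
    (f : c.Fam Y k) : f.toΦ m ≫ L.map (((β.ρ m).app Y).f k) =
      c.cE Y k f.head ≫ L.map ((β.cε.app Y).f k) := by
  cases m with
  | zero => exact (L.map_isZero hY).eq_of_tgt _ _
  | succ m =>
    suffices conePair L (β.toB (β.ρ m) Y) k (f.shift.toΦ m) (c.cE Y k f.head) ≫
        L.map ((β.coneDesc (β.ρ m) Y).f k) = c.cE Y k f.head ≫ L.map ((β.cε.app Y).f k) from this
    rw [conePair, Preadditive.add_comp, Category.assoc, Category.assoc, ← L.map_comp,
      ← L.map_comp, inl_v_coneDesc_f, inr_f_coneDesc_f, L.map_zero, comp_zero, zero_add]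

theorem toΦ_toB (m : ℕ) (hY : β.Vanishes (m + 1) (Y.X (k + 1))) (f : c.Fam (β.cK.obj Y) (k + 1)) :
    f.toΦ m ≫ L.map ((β.toB (β.ρ m) Y).f (k + 1)) = c.cE _ _ f.head ≫
      L.map ((β.cε.app (β.cK.obj Y)).f (k + 1) ≫ (β.cι.app Y).f (k + 1)) := by
  have := toΦ_ρ m hY f
  rw [toB, HomologicalComplex.comp_f, L.map_comp, L.map_comp, reassoc_of% this]

theorem cE_head_d (f : c.Fam Y k) : c.cE Y k f.head ≫ L.map ((β.cB.obj Y).d k (k + 1)) =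
    -c.cE _ _ f.shift.head ≫
      L.map ((β.cε.app (β.cK.obj Y)).f (k + 1) ≫ (β.cι.app Y).f (k + 1)) := by
  rw [← cE_comp_d, head, f.comm 0 k (k + 1) (by simp) (by simp), cE_d]
  rfl

/-- The first cone component is a cocycle by induction, applied to the shifted family. The second
cone equation is the compatibility of the components `0` and `1` of the family. -/
theorem toΦ_d (m : ℕ) : ∀ {Y : CochainComplex A ℤ} {k : ℤ} (_ : ∀ i, β.Vanishes m (Y.X i))
    (f : c.Fam Y k), f.toΦ m ≫ L.map (((β.R m).obj Y).d k (k + 1)) = 0 := by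
  induction m with
  | zero => exact fun _ f => zero_comp
  | succ m ih =>
    intro Y k hY f
    refine conePair_d _ _ _ _ _ (ih (Y := β.cK.obj Y) hY f.shift) ?_
    rw [toΦ_toB m (hY _), cE_head_d, add_neg_cancel]

theorem toΦ_injective (m : ℕ) : ∀ {Y : CochainComplex A ℤ} {k : ℤ}
    (_ : ∀ i, β.Vanishes m (Y.X i)) (f g : c.Fam Y k), f.toΦ m = g.toΦ m → f = g := by
  induction m with
  | zero =>
    intro Y k hY f g _
    ext i j h
    exact (hY j).eq_of_tgt _ _
  | succ m ih =>
    intro Y k hY f g h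
    rw [toΦ_succ, toΦ_succ] at h
    have h₁ := congr_arg (· ≫ L.map ((mappingCone.fst _).1.v k (k + 1) rfl)) h
    have h₂ := congr_arg (· ≫ L.map ((mappingCone.snd _).v k k (add_zero k))) h
    simp only [conePair_fst, conePair_snd] at h₁ h₂
    ext i j hj
    obtain rfl | i := i
    · obtain rfl : k = j := by simpa using hj
      exact (c.cE Y k).injective h₂
    · apply (c.cΚ Y i j).injective
      exact congr_arg (fun f => f.f i j (by lia)) (ih (Y := β.cK.obj Y) hY _ _ h₁)

/-- In a cocycle $(a,b)$ of the cone, $b$ gives the component of index `0`, and $a$ gives by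
induction a family into the syzygies, hence all components of positive index. The remaining cone
equation is the compatibility at index `0`. -/
theorem toΦ_surjective (m : ℕ) : ∀ {Y : CochainComplex A ℤ} {k : ℤ}
    (_ : ∀ i, β.Vanishes m (Y.X i)) (z : Z ⟶ L.obj (((β.R m).obj Y).X k))
    (_ : z ≫ L.map (((β.R m).obj Y).d k (k + 1)) = 0), ∃ f : c.Fam Y k, f.toΦ m = z := by
  induction m with
  | zero =>
    intro Y k hY z _
    exact ⟨⟨fun _ _ _ => 0, fun _ _ _ _ _ => by simp⟩, (L.map_isZero (hY k)).eq_of_tgt _ _⟩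
  | succ m ih =>
    intro Y k hY z hz
    obtain ⟨a, b, rfl, ha, hb⟩ := exists_conePair L (β.toB (β.ρ m) Y) k z hz
    obtain ⟨f, rfl⟩ := ih (Y := β.cK.obj Y) hY a ha
    let g (i : ℕ) (j : ℤ) (h : k + i = j) : c.D i ⟶ Y.X j :=
      match i, h with
      | 0, h => (c.cE Y j).symm (b ≫ L.map ((HomologicalComplex.XIsoOfEq _ (by simpa using h)).hom))
      | i + 1, h => (c.cΚ Y i j).symm (f.f i j (by lia))
    have hg0 : c.cE Y k (g 0 k (by simp)) = b := by simp [g]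
    have hg (i : ℕ) (j : ℤ) (h : k + 1 + i = j) :
        c.cΚ Y i j (g (i + 1) j (by lia)) = f.f i j h := by simp [g]
    refine ⟨⟨g, ?_⟩, ?_⟩
    · intro i j j' h h'
      obtain rfl | i := i
      · obtain rfl : k = j := by simpa using h
        obtain rfl : k + 1 = j' := by simpa using h'
        apply (c.cE Y _).injective
        rw [cE_comp_d, cE_d, hg0, hg 0 (k + 1) (by simp), ← add_eq_zero_iff_eq_neg]
        refine (add_comm _ _).trans ?_
        rw [toΦ_toB m (hY _)] at hb
        exact hb
      · apply (c.cΚ Y i j').injective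
        rw [cΚ_d, cΚ_comp_d, hg i j (by lia), hg (i + 1) j' (by lia), f.comm]
    · rw [toΦ_succ]
      refine congr_arg₂ _ (congr_arg _ ?_) hg0
      ext i j h
      exact hg i j h

end Fam

end Corepresentation

end BarData

open CochainComplex

/-! ### Morphisms in the derived category out of a K-projective complex -/

section KProjective

variable {A : Type u₁} [Category.{v₁} A] [Abelian A] [HasDerivedCategory.{w₁} A]
  (M N : CochainComplex A ℤ) [M.IsKProjective]

theorem Q_map_surjective_of_isKProjective :
    Function.Surjective (DerivedCategory.Q.map : (M ⟶ N) → _) := by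
  intro f
  obtain ⟨g, hg⟩ := (CochainComplex.IsKProjective.Qh_map_bijective M
    ((HomotopyCategory.quotient _ _).obj N)).2 ((DerivedCategory.quotientCompQhIso A).hom.app M ≫ f ≫
      (DerivedCategory.quotientCompQhIso A).inv.app N)
  obtain ⟨g, rfl⟩ := (HomotopyCategory.quotient _ _).map_surjective g
  refine ⟨g, ?_⟩
  have := DerivedCategory.quotientCompQhIso_hom_naturality g
  rw [hg] at this
  rw [← cancel_epi ((DerivedCategory.quotientCompQhIso A).hom.app M), ← this]
  simp

variable {M N}

theorem nonempty_homotopy_of_Q_map_eq (f g : M ⟶ N)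
    (h : DerivedCategory.Q.map f = DerivedCategory.Q.map g) : Nonempty (Homotopy f g) := by
  refine ⟨HomotopyCategory.homotopyOfEq _ _ ((CochainComplex.IsKProjective.Qh_map_bijective M
    ((HomotopyCategory.quotient _ _).obj N)).1 ?_)⟩
  rw [← cancel_mono ((DerivedCategory.quotientCompQhIso A).hom.app N)]
  erw [DerivedCategory.quotientCompQhIso_hom_naturality f,
    DerivedCategory.quotientCompQhIso_hom_naturality g, h]

instance (Z : A) [Projective Z] :
    CochainComplex.IsKProjective ((HomologicalComplex.single A (ComplexShape.up ℤ) 0).obj Z) := by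
  have (n : ℤ) : Projective (((HomologicalComplex.single A (ComplexShape.up ℤ) 0).obj Z).X n) := by
    by_cases hn : n = 0
    · subst hn
      exact Projective.of_iso (HomologicalComplex.singleObjXSelf _ 0 Z).symm inferInstance
    · exact (HomologicalComplex.isZero_single_obj_X _ _ _ _ hn).projective
  exact CochainComplex.isKProjective_of_projective _ 0

end KProjective

theorem mappingCone_map_add {A : Type u₁} [Category.{v₁} A] [Abelian A]
    {K₁ L₁ K₂ L₂ : CochainComplex A ℤ} (φ₁ : K₁ ⟶ L₁) (φ₂ : K₂ ⟶ L₂) (a a' : K₁ ⟶ K₂)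
    (b b' : L₁ ⟶ L₂) (comm : φ₁ ≫ b = a ≫ φ₂) (comm' : φ₁ ≫ b' = a' ≫ φ₂) :
    mappingCone.map φ₁ φ₂ a b comm + mappingCone.map φ₁ φ₂ a' b' comm' =
      mappingCone.map φ₁ φ₂ (a + a') (b + b')
        (by rw [Preadditive.comp_add, Preadditive.add_comp, comm, comm']) := by
  ext i
  refine mappingCone.ext_from _ (i + 1) i rfl ?_ ?_ <;>
  simp [mappingCone_inl_v_map_f, mappingCone_inr_f_map_f]

namespace BarData

variable {A : Type u₁} [Category.{v₁} A] [Abelian A] {C : Type u₂} [Category.{v₂} C]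
    [Abelian C] {L : A ⥤ C} [L.Additive] (β : BarData L)

theorem additive_coneFunctor {R : CochainComplex A ℤ ⥤ CochainComplex A ℤ} (ρ : R ⟶ 𝟭 _)
    [R.Additive] : (β.coneFunctor ρ).Additive where
  map_add {Y Y' f g} := by
    refine Eq.trans ?_ (mappingCone_map_add _ _ _ _ _ _ (β.toB_naturality ρ f)
      (β.toB_naturality ρ g)).symm
    simp only [coneFunctor_map, Functor.map_add]
    rfl

instance additive_R (m : ℕ) : (β.R m).Additive := by
  induction m with
  | zero => exact inferInstanceAs (𝟭 (CochainComplex A ℤ)).Additive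
  | succ m ih => exact β.additive_coneFunctor (β.ρ m)

variable [HasDerivedCategory.{w₁} A] [HasDerivedCategory.{w₂} C] {m : ℕ}
  (hm : ∀ F, β.Vanishes m F)

/-- Additivity descends from complexes to the homotopy category, whose quotient functor is full and
essentially surjective, and then through the localization. It reduces injectivity of the
corepresenting map to the triviality of a kernel. -/
instance additive_derived : (β.derived hm).Additive := by
  have h₁ : (DerivedCategory.Q ⋙ β.derived hm).Additive :=
    Functor.additive_of_iso (β.derivedIso hm).symm
  have h₂ : ((HomotopyCategory.quotient A (ComplexShape.up ℤ)) ⋙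
      DerivedCategory.Qh ⋙ β.derived hm).Additive :=
    Functor.additive_of_iso (Functor.isoWhiskerRight (DerivedCategory.quotientCompQhIso A)
      (β.derived hm)).symm
  have h₃ : (DerivedCategory.Qh ⋙ β.derived hm).Additive :=
    Functor.additive_of_full_essSurj_comp (HomotopyCategory.quotient A (ComplexShape.up ℤ)) _
  exact (Localization.functor_additive_iff DerivedCategory.Qh
    (HomotopyCategory.subcategoryAcyclic A).trW _).2 h₃

end BarData

/-! ### The complex of corepresenting objects and its universal property -/

namespace BarData.Corepresentation

variable {A : Type u₁} [Category.{v₁} A] [Abelian A] {C : Type u₂} [Category.{v₂} C]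
    [Abelian C] {L : A ⥤ C} [L.Additive] {β : BarData L} {Z : C} (c : β.Corepresentation Z)

open ZeroObject in
/-- The terms of the complex of corepresenting objects. -/
def cX : ℤ → A
  | .ofNat i => c.D i
  | .negSucc _ => 0

theorem isZero_cX (n : ℤ) (hn : n < 0) : IsZero (c.cX n) := by
  obtain i | i := n
  · exact absurd hn (by simp)
  · exact isZero_zero A

/-- The differentials of the complex of corepresenting objects. -/
def cd : ∀ n : ℤ, c.cX n ⟶ c.cX (n + 1)
  | .ofNat i => c.d i
  | .negSucc _ => 0

theorem cd_comp_cd (n : ℤ) : c.cd n ≫ c.cd (n + 1) = 0 := by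
  obtain i | i := n
  · exact c.d_comp_d i
  · exact zero_comp

/-- The complex of corepresenting objects. -/
def complex : CochainComplex A ℤ := CochainComplex.of c.cX c.cd c.cd_comp_cd

theorem complex_d (n : ℤ) : c.complex.d n (n + 1) = c.cd n := CochainComplex.of_d _ _ _

variable {c} {Y : CochainComplex A ℤ}

/-- The components of a morphism from the complex of corepresenting objects. -/
def component (g : c.complex ⟶ Y) (i : ℕ) : c.D i ⟶ Y.X (Int.ofNat i) := g.f (Int.ofNat i)

theorem component_d (g : c.complex ⟶ Y) (i : ℕ) : component g i ≫
    Y.d (Int.ofNat i) (Int.ofNat (i + 1)) = c.d i ≫ component g (i + 1) := by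
  have := g.comm (Int.ofNat i) (Int.ofNat i + 1)
  rw [complex_d] at this
  exact this

theorem component_comp (g : c.complex ⟶ Y) {Y' : CochainComplex A ℤ} (φ : Y ⟶ Y') (i : ℕ) :
    component (g ≫ φ) i = component g i ≫ φ.f (Int.ofNat i) := rfl

/-- The family given by a morphism from the complex of corepresenting objects. -/
def toFam (g : c.complex ⟶ Y) : c.Fam Y 0 where
  f i j h := component g i ≫ (Y.XIsoOfEq (by simpa using h)).hom
  comm i j j' h h' := by
    obtain rfl : Int.ofNat i = j := by simpa using h
    obtain rfl : Int.ofNat (i + 1) = j' := by simpa using h'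
    simp only [HomologicalComplex.XIsoOfEq_rfl, Iso.refl_hom, Category.comp_id, component_d]

/-- The morphism from the complex of corepresenting objects given by a family. -/
def Fam.hom (f : c.Fam Y 0) : c.complex ⟶ Y where
  f
    | .ofNat i => f.f i (.ofNat i) (by simp)
    | .negSucc i => (0 : c.cX (.negSucc i) ⟶ Y.X (.negSucc i))
  comm' n n' h := by
    obtain rfl : n + 1 = n' := h
    rw [complex_d]
    obtain i | i := n
    · exact f.comm i _ _ _ _
    · exact (c.isZero_cX _ (Int.negSucc_lt_zero i)).eq_of_src _ _

theorem toFam_hom (f : c.Fam Y 0) : toFam f.hom = f := by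
  ext i j h
  obtain rfl : Int.ofNat i = j := by simpa using h
  exact Category.comp_id _

theorem hom_toFam (g : c.complex ⟶ Y) : (toFam g).hom = g := by
  ext n
  obtain i | i := n
  · exact Category.comp_id _
  · exact (c.isZero_cX _ (Int.negSucc_lt_zero i)).eq_of_src _ _

theorem toFam_comp (g : c.complex ⟶ Y) {Y' : CochainComplex A ℤ} (φ : Y ⟶ Y') :
    toFam (g ≫ φ) = (toFam g).map φ := by
  ext i j h
  obtain rfl : Int.ofNat i = j := by simpa using h
  simp only [toFam, Fam.map_f, component_comp, HomologicalComplex.XIsoOfEq_rfl, Iso.refl_hom,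
    Category.comp_id]

variable {m : ℕ} (hm : ∀ F, β.Vanishes m F)

/-- The morphism to the complex `Φ` that corresponds to a morphism from the complex of
corepresenting objects. -/
def comparison (g : c.complex ⟶ Y) :
    (HomologicalComplex.single C (ComplexShape.up ℤ) 0).obj Z ⟶ (β.Φ m).obj Y :=
  HomologicalComplex.mkHomFromSingle (K := (β.Φ m).obj Y) ((toFam g).toΦ m) (fun k hk => by
    obtain rfl : 0 + 1 = k := hk
    exact Fam.toΦ_d m (fun i => hm _) _)

theorem comparison_f (g : c.complex ⟶ Y) : (comparison hm g).f 0 =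
    (HomologicalComplex.singleObjXSelf (ComplexShape.up ℤ) 0 Z).hom ≫ (toFam g).toΦ m :=
  HomologicalComplex.mkHomFromSingle_f _ _

theorem comparison_comp (g : c.complex ⟶ Y) {Y' : CochainComplex A ℤ} (φ : Y ⟶ Y') :
    comparison hm (g ≫ φ) = comparison hm g ≫ (β.Φ m).map φ := by
  apply HomologicalComplex.from_single_hom_ext
  rw [HomologicalComplex.comp_f, comparison_f, comparison_f, toFam_comp, Fam.toΦ_map]
  exact (Category.assoc _ _ _).symm

theorem comparison_injective {g g' : c.complex ⟶ Y} (h : comparison hm g = comparison hm g') :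
    g = g' := by
  have h₀ := congr_arg (fun f => HomologicalComplex.Hom.f f 0) h
  simp only [comparison_f] at h₀
  rw [← hom_toFam g, ← hom_toFam g',
    Fam.toΦ_injective m (fun i => hm _) _ _ ((cancel_epi _).1 h₀)]

theorem exists_comparison_eq
    (t : (HomologicalComplex.single C (ComplexShape.up ℤ) 0).obj Z ⟶ (β.Φ m).obj Y) :
    ∃ g : c.complex ⟶ Y, comparison hm g = t := by
  obtain ⟨f, hf⟩ := Fam.toΦ_surjective (c := c) m (Y := Y) (k := 0) (fun i => hm _)
    ((HomologicalComplex.singleObjXSelf (ComplexShape.up ℤ) 0 Z).inv ≫ t.f 0) (by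
      have := t.comm 0 (0 + 1)
      rw [HomologicalComplex.single_obj_d, zero_comp] at this
      refine (Category.assoc _ _ _).trans ((congr_arg _ this).trans comp_zero))
  refine ⟨f.hom, ?_⟩
  apply HomologicalComplex.from_single_hom_ext
  rw [comparison_f, toFam_hom, hf]
  exact Iso.hom_inv_id_assoc _ _

/-- A morphism from the complex of corepresenting objects factors through a contractible complex
if the corresponding morphism to `Φ` is null-homotopic. -/
theorem Q_map_eq_zero [HasDerivedCategory.{w₁} A] (g : c.complex ⟶ Y)
    (h : Homotopy (comparison hm g) 0) : DerivedCategory.Q.map g = 0 := by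
  -- This object vanishes in the derived category, while its projection to `Y` is a degreewise split
  -- epimorphism, so the resolutions keep degreewise sections of it.
  let P := mappingCocone (𝟙 Y)
  let p : P ⟶ Y := mappingCocone.fst (𝟙 Y)
  have hP : IsZero (DerivedCategory.Q.obj P) :=
    Pretriangulated.Triangle.isZero₁_of_isIso₂ _
      (DerivedCategory.mappingCocone_triangle_distinguished (𝟙 Y))
        (inferInstanceAs (IsIso (DerivedCategory.Q.map (𝟙 Y))))
  obtain ⟨s, hs⟩ : ∃ s : ((β.Φ m).obj Y).X (-1) ⟶ ((β.Φ m).obj P).X (-1),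
      s ≫ ((β.Φ m).map p).f (-1) = 𝟙 _ := by
    obtain ⟨s, hs⟩ := β.R_map_section m p (fun i =>
      ⟨(mappingCocone.inl (𝟙 Y)).v i i (add_zero i), mappingCocone.inl_v_fst_f _ _⟩) (-1)
    exact ⟨L.map s, (L.map_comp _ _).symm.trans ((congr_arg _ hs).trans (L.map_id _))⟩
  have hw := h.comm 0
  rw [dNext_eq _ (show (ComplexShape.up ℤ).Rel 0 (0 + 1) from rfl),
    prevD_eq _ (show (ComplexShape.up ℤ).Rel (-1) 0 from rfl), HomologicalComplex.single_obj_d,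
    zero_comp, zero_add, HomologicalComplex.zero_f, add_zero] at hw
  -- The null-homotopy is a cochain of degree $-1$. Its lift along `s`, a section in that single
  -- degree, has as boundary a degree $0$ cocycle over `P`, and this cocycle comes from a chain map
  -- `g'`.
  obtain ⟨g', hg'⟩ : ∃ g' : c.complex ⟶ P, comparison hm g = comparison hm g' ≫ (β.Φ m).map p := by
    have hd : s ≫ ((β.Φ m).obj P).d (-1) 0 ≫ ((β.Φ m).map p).f 0 =
        ((β.Φ m).obj Y).d (-1) 0 := by
      rw [← HomologicalComplex.Hom.comm, ← Category.assoc, hs, Category.id_comp]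
    obtain ⟨g', hg'⟩ := exists_comparison_eq (c := c) hm (Y := P)
      (HomologicalComplex.mkHomFromSingle (K := (β.Φ m).obj P)
        ((HomologicalComplex.singleObjXSelf (ComplexShape.up ℤ) 0 Z).inv ≫ h.hom 0 (-1) ≫
          s ≫ ((β.Φ m).obj P).d (-1) 0) (fun k _ => by
            simp only [Category.assoc, HomologicalComplex.d_comp_d, comp_zero]))
    refine ⟨g', ?_⟩
    apply HomologicalComplex.from_single_hom_ext
    rw [hg', HomologicalComplex.comp_f, HomologicalComplex.mkHomFromSingle_f, hw]
    simp only [Category.assoc, Iso.hom_inv_id_assoc]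
    rw [hd]
  rw [← comparison_comp] at hg'
  rw [comparison_injective hm hg', Functor.map_comp, hP.eq_of_tgt (DerivedCategory.Q.map g') 0,
    zero_comp]

section

variable (c) [HasDerivedCategory.{w₁} A] [HasDerivedCategory.{w₂} C]

/-- The class that corepresents `Hom(Z, derived(-))`. -/
def universalClass : DerivedCategory.Q.obj
    ((HomologicalComplex.single C (ComplexShape.up ℤ) 0).obj Z) ⟶
      (β.derived hm).obj (DerivedCategory.Q.obj c.complex) :=
  DerivedCategory.Q.map (comparison hm (𝟙 c.complex)) ≫ (β.derivedIso hm).inv.app c.complex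

theorem universalClass_map (g : c.complex ⟶ Y) :
    c.universalClass hm ≫ (β.derived hm).map (DerivedCategory.Q.map g) =
      DerivedCategory.Q.map (comparison hm g) ≫ (β.derivedIso hm).inv.app Y := by
  have h : DerivedCategory.Q.map ((β.Φ m).map g) ≫ (β.derivedIso hm).inv.app Y =
      (β.derivedIso hm).inv.app c.complex ≫ (β.derived hm).map (DerivedCategory.Q.map g) :=
    (β.derivedIso hm).inv.naturality g
  rw [universalClass, Category.assoc, ← h, ← Functor.map_comp_assoc, ← comparison_comp,
    Category.id_comp]

variable [Projective Z]

/-- Projectivity of `Z` makes morphisms from it in the derived category homotopy classes of chain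
maps. Surjectivity follows as every such chain map comes from the corepresenting complex. For
injectivity, clearing the denominator of a fraction leaves a chain map whose comparison is
null-homotopic. -/
theorem universalClass_bijective (F : DerivedCategory A) : Function.Bijective
    (fun f : DerivedCategory.Q.obj c.complex ⟶ F =>
      c.universalClass hm ≫ (β.derived hm).map f) := by
  constructor
  · intro f f' hf
    rw [← sub_eq_zero]
    replace hf : c.universalClass hm ≫ (β.derived hm).map (f - f') = 0 := by
      rw [Functor.map_sub, Preadditive.comp_sub, sub_eq_zero]
      exact hf
    generalize f - f' = f at hf
    rw [← cancel_mono (DerivedCategory.Q.objObjPreimageIso F).inv, zero_comp]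
    obtain ⟨Y, g, s, hs, fac⟩ := DerivedCategory.left_fac
      (f ≫ (DerivedCategory.Q.objObjPreimageIso F).inv)
    rw [fac]
    suffices DerivedCategory.Q.map g = 0 by rw [this, zero_comp]
    have hg : DerivedCategory.Q.map g =
        f ≫ (DerivedCategory.Q.objObjPreimageIso F).inv ≫ DerivedCategory.Q.map s := by
      rw [← Category.assoc, fac, Category.assoc, IsIso.inv_hom_id, Category.comp_id]
    have h := c.universalClass_map hm g
    rw [hg, Functor.map_comp, reassoc_of% hf, zero_comp, eq_comm,
      ← zero_comp (f := (β.derivedIso hm).inv.app Y), cancel_mono,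
      ← Functor.map_zero DerivedCategory.Q] at h
    obtain ⟨h⟩ := nonempty_homotopy_of_Q_map_eq _ _ h
    exact Q_map_eq_zero hm g h
  · intro t
    let e := DerivedCategory.Q.objObjPreimageIso F
    obtain ⟨t', ht'⟩ := Q_map_surjective_of_isKProjective _ _
      (t ≫ (β.derived hm).map e.inv ≫ (β.derivedIso hm).hom.app _)
    obtain ⟨g, rfl⟩ := exists_comparison_eq (c := c) hm t'
    refine ⟨DerivedCategory.Q.map g ≫ e.hom, ?_⟩
    dsimp only
    have he : (β.derivedIso hm).hom.app (DerivedCategory.Q.objPreimage F) ≫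
        (β.derivedIso hm).inv.app (DerivedCategory.Q.objPreimage F) =
        𝟙 ((β.derived hm).obj (DerivedCategory.Q.obj (DerivedCategory.Q.objPreimage F))) :=
      Iso.hom_inv_id_app _ _
    rw [Functor.map_comp, ← Category.assoc, universalClass_map, ht', Category.assoc,
      Category.assoc, Category.assoc, reassoc_of% he, ← Functor.map_comp, e.inv_hom_id,
      Functor.map_id, Category.comp_id]

/-- The complex of corepresenting objects corepresents `Hom(Z, derived(-))`. -/
def corepresentableBy : (β.derived hm ⋙ coyoneda.obj (Opposite.op
    (DerivedCategory.Q.obj ((HomologicalComplex.single C (ComplexShape.up ℤ) 0).obj Z)))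
    ).CorepresentableBy (DerivedCategory.Q.obj c.complex) where
  homEquiv := Equiv.ofBijective _ (c.universalClass_bijective hm _)
  homEquiv_comp g f := by
    change c.universalClass hm ≫ (β.derived hm).map (f ≫ g) =
      (c.universalClass hm ≫ (β.derived hm).map f) ≫ (β.derived hm).map g
    rw [Functor.map_comp, Category.assoc]

end

end BarData.Corepresentation

theorem ShortComplex.exact_iff_evaluation {J : Type*} [Category J] {C : Type*} [Category C]
    [Abelian C] (S : ShortComplex (J ⥤ C)) :
    S.Exact ↔ ∀ j, (S.map ((evaluation J C).obj j)).Exact := by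
  simp only [ShortComplex.exact_iff_isZero_homology, Functor.isZero_iff]
  exact forall_congr' fun j => (S.mapHomologyIso ((evaluation J C).obj j)).symm.isZero_iff

end CategoryTheory

/-! ### The bar construction on a poset -/

namespace FinitePoset

variable {P : Type u} [PartialOrder P] (F : P ⥤ AddCommGrpCat.{u}) {G : P ⥤ AddCommGrpCat.{u}}

/-- Families of elements of the groups `F.obj x`. -/
abbrev Family : Type u := ∀ x, F.obj x

variable {F} in
/-- The action of a morphism on families. -/
def mapFamily (g : F ⟶ G) : Family F →+ Family G where
  toFun s x := (g.app x).hom (s x)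
  map_zero' := by ext; simp
  map_add' s t := by ext; simp

@[simp]
theorem mapFamily_apply (g : F ⟶ G) (s : Family F) (x : P) :
    mapFamily g s x = (g.app x).hom (s x) := rfl

open Classical in
/-- The transition map of `F`, extended by zero to pairs of points which are not comparable. -/
def transfer (x y : P) : F.obj x →+ F.obj y := if h : x ≤ y then (F.map (homOfLE h)).hom else 0

theorem transfer_of_le {x y : P} (h : x ≤ y) : transfer F x y = (F.map (homOfLE h)).hom := dif_pos h

theorem transfer_of_not_le {x y : P} (h : ¬x ≤ y) : transfer F x y = 0 := dif_neg h

theorem transfer_self (x : P) (s : F.obj x) : transfer F x x s = s := by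
  rw [transfer_of_le F le_rfl]
  exact congr($(F.map_id x).hom s)

theorem map_transfer {x y z : P} (hxy : x ≤ y) (f : y ⟶ z) (s : F.obj x) :
    (F.map f).hom (transfer F x y s) = transfer F x z s := by
  rw [transfer_of_le F hxy, transfer_of_le F (hxy.trans (leOfHom f))]
  exact congr($(F.map_comp (homOfLE hxy) f).hom s).symm

theorem app_transfer (g : F ⟶ G) (x y : P) (s : F.obj x) :
    (g.app y).hom (transfer F x y s) = transfer G x y ((g.app x).hom s) := by
  by_cases h : x ≤ y
  · rw [transfer_of_le F h, transfer_of_le G h]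
    exact congr($(g.naturality (homOfLE h)).hom s)
  · simp [transfer_of_not_le _ h]

/-- The families supported on the points below `y`. -/
def down (y : P) : AddSubgroup (Family F) where
  carrier := {s | ∀ x, ¬x ≤ y → s x = 0}
  zero_mem' := fun _ _ => rfl
  add_mem' := fun hs ht x hx => by rw [Pi.add_apply, hs x hx, ht x hx, add_zero]
  neg_mem' := fun hs x hx => by rw [Pi.neg_apply, hs x hx, neg_zero]

theorem down_mono {y z : P} (h : y ≤ z) : down F y ≤ down F z :=
  fun _ hs x hx => hs x fun hxy => hx (hxy.trans h)

theorem mapFamily_mem_down (g : F ⟶ G) {y : P} {s : Family F} (hs : s ∈ down F y) :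
    mapFamily g s ∈ down G y := fun x hx => by rw [mapFamily_apply, hs x hx, map_zero]

section

variable [DecidableEq P]

/-- The family with one nonzero component. -/
abbrev single (x : P) : F.obj x →+ Family F := AddMonoidHom.single (fun x => F.obj x) x

theorem single_of_ne {x z : P} (h : z ≠ x) (s : F.obj x) : single F x s z = 0 :=
  Pi.single_eq_of_ne (M := fun x => F.obj x) h s

theorem single_mem_down {x y : P} (h : x ≤ y) (s : F.obj x) : single F x s ∈ down F y := by
  intro z hz
  refine single_of_ne F (fun e => hz ?_) s
  rwa [e]

end

variable (P) in
/-- The functor of families supported below a point. -/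
def bar : (P ⥤ AddCommGrpCat.{u}) ⥤ P ⥤ AddCommGrpCat.{u} where
  obj F :=
    { obj y := AddCommGrpCat.of (down F y)
      map f := AddCommGrpCat.ofHom (AddSubgroup.inclusion (down_mono F (leOfHom f))) }
  map {F G} g :=
    { app y := AddCommGrpCat.ofHom (((mapFamily g).comp (down F y).subtype).codRestrict (down G y)
        fun s => mapFamily_mem_down F g s.2) }

instance : (bar P).Additive where
  map_add {F G f g} := by
    ext y s
    exact Subtype.ext (funext fun x => rfl)

/-- The inclusion of a point in the poset gives the families concentrated at this point. -/
def inject [DecidableEq P] (x : P) : F.obj x →+ ((bar P).obj F).obj x :=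
  (single F x).codRestrict (down F x) fun s => single_mem_down F le_rfl s

theorem coe_transfer_bar {x y : P} (h : x ≤ y) (s : ((bar P).obj F).obj x) :
    (transfer ((bar P).obj F) x y s).1 = s.1 := by
  rw [transfer_of_le _ h]
  rfl

/-- At `y` the functor is a product of stalks, so preimages can be chosen one point at a time;
replacing them by zero off the points below `y` keeps the support condition. -/
theorem preservesHomology_bar : (bar P).PreservesHomology := by
  classical
  refine Functor.preservesHomology_of_map_exact _ fun S hS => ?_
  rw [ShortComplex.exact_iff_evaluation] at hS ⊢
  intro y
  rw [ShortComplex.ab_exact_iff]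
  rintro ⟨s, hs⟩ h
  have h' (x : P) : ∃ t : S.X₁.obj x, (S.f.app x).hom t = s x :=
    (ShortComplex.ab_exact_iff _).1 (hS x) (s x) (congr_fun (congrArg Subtype.val h) x)
  choose t ht using h'
  refine ⟨⟨fun x => if x ≤ y then t x else 0, fun x hx => if_neg hx⟩, Subtype.ext ?_⟩
  ext x
  refine (?_ : (S.f.app x).hom (if x ≤ y then t x else 0) = s x)
  split_ifs with hx
  · exact ht x
  · rw [map_zero, hs x hx]

variable (P) in
/-- The functor of all families. -/
def family : (P ⥤ AddCommGrpCat.{u}) ⥤ AddCommGrpCat.{u} where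
  obj F := AddCommGrpCat.of (Family F)
  map g := AddCommGrpCat.ofHom (mapFamily g)

instance : (family P).Additive where

theorem preservesHomology_family : (family P).PreservesHomology := by
  refine Functor.preservesHomology_of_map_exact _ fun S hS => ?_
  rw [ShortComplex.exact_iff_evaluation] at hS
  rw [ShortComplex.ab_exact_iff]
  intro s h
  choose t ht using fun x =>
    (ShortComplex.ab_exact_iff _).1 (hS x) (s x) (congr_fun h x)
  exact ⟨t, funext ht⟩

variable [Fintype P]

/-- A family is the sum of its one-point components, each coming from the stalk at its own point.
This gives both the splitting by the comultiplication and the computation of the colimit. -/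
theorem sum_transfer_inject [DecidableEq P] {y : P} (s : ((bar P).obj F).obj y) :
    ∑ x, transfer ((bar P).obj F) x y (inject F x (s.1 x)) = s := by
  refine Subtype.ext ((AddSubgroup.val_finsetSum (G := Family F) _ _ _).trans ?_)
  refine (Finset.sum_congr rfl fun x _ => ?_).trans (Finset.univ_sum_single s.1)
  by_cases h : x ≤ y
  · exact coe_transfer_bar F h _
  · rw [transfer_of_not_le _ h, s.2 x h, Pi.single_zero]
    rfl

/-- The sum of the images in `F.obj y` of the components of a family at the points below `y`. -/
def push (y : P) : Family F →+ F.obj y :=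
  ∑ x, (transfer F x y).comp (Pi.evalAddMonoidHom (fun x => F.obj x) x)

theorem push_apply (y : P) (s : Family F) : push F y s = ∑ x, transfer F x y (s x) := by
  simp [push]

theorem map_push {y z : P} (f : y ⟶ z) {s : Family F} (hs : s ∈ down F y) :
    (F.map f).hom (push F y s) = push F z s := by
  rw [push_apply, push_apply, map_sum]
  refine Finset.sum_congr rfl fun x _ => ?_
  by_cases h : x ≤ y
  · exact map_transfer F h f _
  · simp [hs x h]

theorem app_push (g : F ⟶ G) (y : P) (s : Family F) :
    (g.app y).hom (push F y s) = push G y (mapFamily g s) := by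
  simp [push_apply, app_transfer]

theorem push_single [DecidableEq P] (x y : P) (s : F.obj x) :
    push F y (single F x s) = transfer F x y s := by
  rw [push_apply, Finset.sum_eq_single x]
  · simp
  · intro z _ hz
    simp [hz]
  · simp

/-- The families supported below `y` whose sum in `F.obj y` is zero. -/
def syzygies (y : P) : AddSubgroup (Family F) := down F y ⊓ (push F y).ker

theorem syzygies_mono {y z : P} (h : y ≤ z) : syzygies F y ≤ syzygies F z := by
  intro s hs
  refine ⟨down_mono F h hs.1, ?_⟩
  have := map_push F (homOfLE h) hs.1
  rw [AddMonoidHom.mem_ker.1 hs.2, map_zero] at this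
  exact this.symm

theorem mapFamily_mem_syzygies (g : F ⟶ G) {y : P} {s : Family F} (hs : s ∈ syzygies F y) :
    mapFamily g s ∈ syzygies G y := by
  refine ⟨mapFamily_mem_down F g hs.1, ?_⟩
  exact (app_push F g y s).symm.trans ((congrArg _ hs.2).trans (map_zero _))

variable (P) in
/-- The functor of syzygies. -/
def syz : (P ⥤ AddCommGrpCat.{u}) ⥤ P ⥤ AddCommGrpCat.{u} where
  obj F :=
    { obj y := AddCommGrpCat.of (syzygies F y)
      map f := AddCommGrpCat.ofHom (AddSubgroup.inclusion (syzygies_mono F (leOfHom f))) }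
  map {F G} g :=
    { app y := AddCommGrpCat.ofHom (((mapFamily g).comp (syzygies F y).subtype).codRestrict
        (syzygies G y) fun s => mapFamily_mem_syzygies F g s.2) }

instance : (syz P).Additive where
  map_add {F G f g} := by
    ext y s
    exact Subtype.ext (funext fun x => rfl)

variable (P) in
/-- The inclusion of the syzygies. -/
def syzι : syz P ⟶ bar P where
  app F := { app y := AddCommGrpCat.ofHom (AddSubgroup.inclusion inf_le_left) }

variable (P) in
/-- The augmentation. -/
def barε : bar P ⟶ 𝟭 (P ⥤ AddCommGrpCat.{u}) where
  app F :=
    { app y := AddCommGrpCat.ofHom ((push F y).comp (down F y).subtype)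
      naturality y z f := by
        ext s
        exact (map_push F f s.2).symm }
  naturality F G g := by
    ext y s
    exact (app_push F g y s.1).symm

theorem syzι_barε : (syzι P).app F ≫ (barε P).app F = 0 := by
  ext y s
  exact s.2.2

theorem shortExact_syz : (ShortComplex.mk _ _ (syzι_barε F)).ShortExact where
  exact := by
    rw [ShortComplex.exact_iff_evaluation]
    intro y
    rw [ShortComplex.ab_exact_iff]
    exact fun s hs => ⟨⟨s.1, s.2, hs⟩, rfl⟩
  mono_f := by
    rw [NatTrans.mono_iff_mono_app]
    intro y
    rw [AddCommGrpCat.mono_iff_injective]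
    exact AddSubgroup.inclusion_injective (inf_le_left : syzygies F y ≤ down F y)
  epi_g := by
    classical
    rw [NatTrans.epi_iff_epi_app]
    intro y
    rw [AddCommGrpCat.epi_iff_surjective]
    intro s
    refine ⟨inject F y s, ?_⟩
    exact (push_single F y y s).trans (transfer_self F y s)

open Classical in
/-- The comultiplication. -/
def barσ : (bar P).obj F ⟶ (bar P).obj ((bar P).obj F) where
  app y := AddCommGrpCat.ofHom
    { toFun s := ⟨fun x => ⟨single F x (s.1 x), single_mem_down F le_rfl _⟩, fun x hx =>
        Subtype.ext ((congrArg (single F x) (s.2 x hx)).trans (map_zero _))⟩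
      map_zero' := by
        ext x : 3
        exact Subtype.ext (map_zero (single F x))
      map_add' s t := by
        ext x : 3
        exact Subtype.ext (map_add (single F x) _ _) }

theorem barσ_barε : barσ F ≫ (barε P).app ((bar P).obj F) = 𝟙 _ := by
  classical
  ext y s
  exact (push_apply _ y _).trans (sum_transfer_inject F s)

/-- Families supported below a point, as families. -/
def barCocone : Cocone ((bar P).obj F) where
  pt := (family P).obj F
  ι := { app y := AddCommGrpCat.ofHom (down F y).subtype }

/-- The groups of all families are the colimits of the groups of families supported below a
point. -/
def isColimitBarCocone [DecidableEq P] : IsColimit (barCocone F) where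
  desc c := AddCommGrpCat.ofHom
    (∑ x, ((c.ι.app x).hom.comp (inject F x)).comp (Pi.evalAddMonoidHom (fun x => F.obj x) x))
  fac c y := by
    ext s
    have h (x : P) : (c.ι.app x).hom (inject F x (s.1 x)) =
        (c.ι.app y).hom (transfer ((bar P).obj F) x y (inject F x (s.1 x))) := by
      by_cases h : x ≤ y
      · rw [transfer_of_le _ h]
        exact congr($(c.w (homOfLE h)).hom _).symm
      · rw [s.2 x h, map_zero, map_zero, map_zero, map_zero]
    refine (AddMonoidHom.finsetSum_apply _ _ _).trans ((Finset.sum_congr rfl fun x _ => h x).trans ?_)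
    rw [← map_sum, sum_transfer_inject]
  uniq c m hm := by
    ext s
    let m' : Family F →+ c.pt := m.hom
    have h (x : P) : (c.ι.app x).hom (inject F x (s x)) = m' (single F x (s x)) :=
      congr($(hm x).hom _).symm
    refine Eq.trans ?_ ((AddMonoidHom.finsetSum_apply _ _ _).trans
      (Finset.sum_congr rfl fun x _ => h x)).symm
    rw [← map_sum m']
    exact congrArg m' (Finset.univ_sum_single s).symm

variable (P) in
/-- The colimit of the groups of families supported below a point. -/
def barColim : bar P ⋙ colim ≅ family P := by
  classical
  exact NatIso.ofComponents
    (fun F => (colimit.isColimit _).coconePointUniqueUpToIso (isColimitBarCocone F)) fun {F G} g => by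
      refine colimit.hom_ext fun y => ?_
      have h (F : P ⥤ AddCommGrpCat.{u}) := (colimit.isColimit ((bar P).obj F)).comp_coconePointUniqueUpToIso_hom
        (isColimitBarCocone F) y
      refine (ι_colimMap_assoc _ _ _).trans ((congrArg (((bar P).map g).app y ≫ ·) (h G)).trans ?_)
      exact (congrArg (· ≫ (family P).map g) (h F)).symm.trans (Category.assoc _ _ _)

end FinitePoset

/-! ### Vanishing of iterated syzygies -/

namespace FinitePoset

variable {P : Type u} [PartialOrder P] [Fintype P] (F : P ⥤ AddCommGrpCat.{u})
  {G : P ⥤ AddCommGrpCat.{u}}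

theorem push_of_eq_zero {y : P} {s : Family F} (hs : s ∈ down F y) (h : ∀ x < y, s x = 0) :
    push F y s = s y := by
  rw [push_apply, Finset.sum_eq_single y, transfer_self]
  · intro x _ hx
    by_cases hxy : x ≤ y
    · rw [h x (lt_of_le_of_ne hxy hx), map_zero]
    · rw [hs x hxy, map_zero]
  · simp

/-- Without components strictly below `y`, the sum at `y` is just the component at `y`. Thus a
syzygy is determined by its components strictly below `y`. -/
theorem eq_zero_of_mem_syzygies {y : P} {s : Family F} (hs : s ∈ syzygies F y)
    (h : ∀ x < y, s x = 0) : s = 0 := by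
  ext x
  by_cases hxy : x ≤ y
  · rcases hxy.lt_or_eq with hx | rfl
    · exact h x hx
    · exact (push_of_eq_zero F hs.1 h).symm.trans hs.2
  · exact hs.1 x hxy

theorem sub_single_mem_syzygies [DecidableEq P] {y : P} {s : Family F} (hs : s ∈ down F y) :
    s - single F y (push F y s) ∈ syzygies F y := by
  refine AddSubgroup.mem_inf.2 ⟨sub_mem hs (single_mem_down F le_rfl _), ?_⟩
  refine (map_sub (push F y) _ _).trans ?_
  rw [push_single, transfer_self, sub_self]

instance additive_colim : (colim : (P ⥤ AddCommGrpCat.{u}) ⥤ AddCommGrpCat.{u}).Additive :=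
  have : (Functor.const P : AddCommGrpCat.{u} ⥤ P ⥤ AddCommGrpCat.{u}).Additive := ⟨rfl⟩
  colimConstAdj.left_adjoint_additive

theorem preservesHomology_bar_colim :
    (bar P ⋙ (colim : (P ⥤ AddCommGrpCat.{u}) ⥤ AddCommGrpCat.{u})).PreservesHomology := by
  have := preservesHomology_family (P := P)
  refine Functor.preservesHomology_of_map_exact _ fun S hS => ?_
  exact ShortComplex.exact_of_iso (S.mapNatIso (barColim P)).symm (hS.map (family P))

variable (P) in
/-- The families of elements, as resolutions for the colimit functor. -/
def barData : BarData (colim : (P ⥤ AddCommGrpCat.{u}) ⥤ AddCommGrpCat.{u}) where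
  B := bar P
  K := syz P
  ι := syzι P
  ε := barε P
  zero F := syzι_barε F
  shortExact F := shortExact_syz F
  σ := barσ
  σ_ε F := barσ_barε F
  preservesHomology_B := preservesHomology_bar
  preservesHomology_L := preservesHomology_bar_colim

-- The number of points strictly below `y` serves as a height. If `F` vanishes at heights less than
-- `k`, its syzygies vanish at heights less than `k + 1`, since a point below `y` has smaller
-- height. All heights are less than the cardinality.
open Classical in
theorem vanishes_of_card_le (m : ℕ) : ∀ (k : ℕ) (F : P ⥤ AddCommGrpCat.{u}),
    (∀ y, (Finset.univ.filter (· < y)).card < k → ∀ s : F.obj y, s = 0) →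
    Fintype.card P ≤ k + m → (barData P).Vanishes m F := by
  have hlt (y : P) : (Finset.univ.filter (· < y)).card < Fintype.card P :=
    Finset.card_lt_univ_of_notMem (x := y) (by simp)
  induction m with
  | zero =>
    intro k F h hk
    refine (Functor.isZero_iff F).2 fun y => ?_
    have : Subsingleton (F.obj y) :=
      subsingleton_of_forall_eq 0 (h y ((hlt y).trans_le hk))
    exact AddCommGrpCat.isZero_of_subsingleton _
  | succ m ih =>
    intro k F h hk
    refine ih (k + 1) ((syz P).obj F) (fun y hy s => Subtype.ext ?_) (by lia)
    refine eq_zero_of_mem_syzygies F s.2 fun x hx => h x ?_ _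
    refine (Finset.card_lt_card ?_).trans_le (Nat.lt_succ_iff.1 hy)
    refine Finset.ssubset_iff_of_subset (fun z hz => ?_) |>.2 ⟨x, by simpa, by simp⟩
    simp only [Finset.mem_filter, Finset.mem_univ, true_and] at hz ⊢
    exact hz.trans hx

theorem vanishes : (barData P).Vanishes (Fintype.card P) F :=
  vanishes_of_card_le _ 0 F (fun _ h => absurd h (Nat.not_lt_zero _)) (by simp)

end FinitePoset

/-! ### Sums over chains corepresent the syzygies -/

namespace FiniteSpace

open FinitePoset

/-- The morphism from the integers with a given value at `1`. -/
def ofInt {A : Type u} [AddCommGroup A] (a : A) : ULift.{u} ℤ →+ A :=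
  (zmultiplesHom A a).comp AddEquiv.ulift.toAddMonoidHom

theorem ofInt_apply {A : Type u} [AddCommGroup A] (a : A) (n : ULift.{u} ℤ) :
    ofInt a n = n.down • a := rfl

theorem smul_apply_one {A : Type u} [AddCommGroup A] (f : ULift.{u} ℤ →+ A) (n : ULift.{u} ℤ) :
    n.down • f ⟨1⟩ = f n := by
  rw [← map_zsmul]
  congr 1
  ext
  simp

instance : Projective intGrp.{u} where
  factors {E Y} f e he := by
    rw [AddCommGrpCat.epi_iff_surjective] at he
    obtain ⟨a, ha⟩ := he (f.hom ⟨1⟩)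
    refine ⟨AddCommGrpCat.ofHom (ofInt a), ?_⟩
    ext n
    rw [← smul_apply_one f.hom n, ← ha, ← map_zsmul]
    rfl

variable {X : Type u} [TopologicalSpace X] [Finite X]

theorem ofEquiv_mem_minOpen {x p : Specialization X} :
    Specialization.ofEquiv p ∈ minOpen (Specialization.ofEquiv x) ↔ x ≤ p :=
  mem_nhdsKer_singleton.trans Specialization.ofEquiv_specializes_ofEquiv

section

variable [T0Space X] [Fintype (Specialization X)] {F G : AbData X}

/-- `1`, as an element of the stalk at `x` of the constant data on the smallest neighborhood. -/
def generator (x : Specialization X) :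
    (supportOn (constInt X) (minOpen (Specialization.ofEquiv x))).obj x :=
  ⟨(⟨1⟩ : ULift ℤ), fun h => absurd (ofEquiv_mem_minOpen.2 le_rfl) h⟩

variable (F) in
/-- The morphisms from `ℤ_{U_x}` are the elements of the stalk at `x`. -/
def supportEquiv (x : Specialization X) :
    (supportOn (constInt X) (minOpen (Specialization.ofEquiv x)) ⟶ F) ≃ F.obj x where
  toFun f := (f.app x).hom (generator x)
  invFun a :=
    { app p := AddCommGrpCat.ofHom ((ofInt (transfer F x p a)).comp
        (supportedSubgroup (constInt X) (minOpen (Specialization.ofEquiv x)) p).subtype)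
      naturality p q f := by
        ext s
        have key (n : ULift.{u} ℤ) (hn : ¬x ≤ p → n = 0) :
            ofInt (transfer F x q a) n = (F.map f).hom (ofInt (transfer F x p a) n) := by
          by_cases h : x ≤ p
          · rw [ofInt_apply, ofInt_apply, map_zsmul, map_transfer F h]
          · rw [hn h, map_zero, map_zero, map_zero]
        exact key s.1 fun h => s.2 fun hp => h (ofEquiv_mem_minOpen.1 hp) }
  left_inv f := by
    ext p s
    refine (?_ : ofInt (transfer F x p ((f.app x).hom (generator x))) s.1 = (f.app p).hom s)
    refine (congrArg (fun b => ofInt b s.1) (app_transfer _ f x p _).symm).trans ?_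
    refine (map_zsmul (f.app p).hom (s.1 : ULift.{u} ℤ).down _).symm.trans
      (congrArg _ (Subtype.ext ?_))
    by_cases h : x ≤ p
    · rw [transfer_of_le _ h]
      exact smul_apply_one (AddMonoidHom.id (ULift.{u} ℤ)) s.1
    · rw [transfer_of_not_le _ h, s.2 fun hp => h (ofEquiv_mem_minOpen.1 hp)]
      exact zero_zsmul 0
  right_inv a := by
    refine (?_ : ofInt (transfer F x x a) ⟨1⟩ = a)
    rw [ofInt_apply, transfer_self]
    exact one_zsmul a

/-- The inclusion of a summand in a sum over chains. -/
def chainι {i : ℕ} (c : StrictChain X i) :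
    supportOn (constInt X) (minOpen (Specialization.ofEquiv (c.1 0))) ⟶ chainSum X i :=
  Limits.Sigma.ι (fun c : StrictChain X i =>
    supportOn (constInt X) (minOpen (Specialization.ofEquiv (c.1 0)))) c

variable (F) in
/-- The morphisms from a sum over chains are the families of elements of the stalks at the first
points of the chains. -/
def chainSumEquiv (i : ℕ) : (chainSum X i ⟶ F) ≃ ∀ c : StrictChain X i, F.obj (c.1 0) where
  toFun f c := supportEquiv F (c.1 0) (chainι c ≫ f)
  invFun a := Limits.Sigma.desc fun c => (supportEquiv F (c.1 0)).symm (a c)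
  left_inv f := by
    refine Limits.Sigma.hom_ext _ _ fun c => ?_
    exact (Limits.Sigma.ι_desc _ _).trans ((supportEquiv F (c.1 0)).symm_apply_apply _)
  right_inv a := by
    ext c
    exact (congrArg (supportEquiv F (c.1 0)) (Limits.Sigma.ι_desc _ c)).trans
      ((supportEquiv F (c.1 0)).apply_symm_apply _)

omit [Fintype (Specialization X)] in
theorem chainSumEquiv_comp {i : ℕ} (f : chainSum X i ⟶ F) (g : F ⟶ G) (c : StrictChain X i) :
    chainSumEquiv G i (f ≫ g) c = (g.app _).hom (chainSumEquiv F i f c) :=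
  congrArg (supportEquiv G (c.1 0)) (Category.assoc _ _ _).symm

/-- The chain without its first point. -/
def StrictChain.tail {i : ℕ} (c : StrictChain X (i + 1)) : StrictChain X i :=
  ⟨fun k => c.1 k.succ, fun _ _ h => c.2 (Fin.succ_lt_succ_iff.2 h)⟩

omit [Finite X] [T0Space X] [Fintype (Specialization X)] in
theorem strictMono_cons {i : ℕ} (c : StrictChain X i) {x : Specialization X} (h : x < c.1 0) :
    StrictMono (Fin.cons x c.1 : Fin (i + 2) → Specialization X) :=
  Fin.strictMono_cons.2 ⟨fun j => h.trans_le (c.2.monotone (Fin.zero_le j)), c.2⟩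

omit [Finite X] [T0Space X] [Fintype (Specialization X)] in
theorem StrictChain.zero_lt {i : ℕ} (c : StrictChain X (i + 1)) : c.1 0 < (StrictChain.tail c).1 0 :=
  c.2 (Fin.succ_pos 0)

/-- The chain with an additional first point. -/
def StrictChain.cons {i : ℕ} (c : StrictChain X i) {x : Specialization X} (h : x < c.1 0) :
    StrictChain X (i + 1) := ⟨Fin.cons x c.1, strictMono_cons c h⟩

variable (F) in
/-- The syzygies at the first point of a chain, evaluated at the points of a longer chain. -/
def evalSyz (i : ℕ) (s : ∀ c : StrictChain X i, ((syz (Specialization X)).obj F).obj (c.1 0))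
    (c : StrictChain X (i + 1)) : F.obj (c.1 0) := (s (StrictChain.tail c)).1 (c.1 0)

-- A chain of length `i + 1` is a chain of length `i` with a point added strictly below its first
-- point $y$. A syzygy at $y$ is given freely by its components there: the component at $y$ is
-- forced to be minus the sum of their images.
omit [Finite X] in
theorem evalSyz_bijective (i : ℕ) : Function.Bijective (evalSyz F i) := by
  classical
  constructor
  · intro s t h
    ext c : 1
    refine Subtype.ext (sub_eq_zero.1 (eq_zero_of_mem_syzygies F (sub_mem (s c).2 (t c).2)
      fun x hx => sub_eq_zero.2 ?_))
    exact congr_fun h (StrictChain.cons c hx)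
  · intro a
    let t (c : StrictChain X i) : Family F := fun x =>
      if h : x < c.1 0 then a (StrictChain.cons c h) else 0
    have ht c : t c ∈ down F (c.1 0) := fun x hx => dif_neg fun h => hx h.le
    refine ⟨fun c => ⟨_, sub_single_mem_syzygies F (ht c)⟩, ?_⟩
    ext c
    have h := StrictChain.zero_lt c
    have hc : StrictChain.cons (StrictChain.tail c) h = c := Subtype.ext (Fin.cons_self_tail c.1)
    -- The values at equal chains lie in stalks that are only propositionally equal, so they are
    -- compared through a transition map.
    have key {c d : StrictChain X (i + 1)} (e : c = d) (e₀ : c.1 0 = d.1 0) :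
        (F.map (eqToHom e₀)).hom (a c) = a d := by
      subst e
      exact congr($(F.map_id _).hom _)
    refine (?_ : t (StrictChain.tail c) (c.1 0) - single F _ _ (c.1 0) = a c)
    rw [single_of_ne F h.ne, sub_zero]
    refine (dif_pos h).trans ?_
    exact congr($(F.map_id _).hom _).symm.trans (key hc rfl)

variable (F) in
/-- The families indexed by chains, in terms of those of syzygies indexed by shorter chains. -/
def evalSyzEquiv (i : ℕ) : (∀ c : StrictChain X i, ((syz (Specialization X)).obj F).obj (c.1 0)) ≃
    ∀ c : StrictChain X (i + 1), F.obj (c.1 0) := Equiv.ofBijective _ (evalSyz_bijective i)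

variable (F) in
/-- The morphisms from consecutive sums over chains. -/
def consEquiv (i : ℕ) :
    (chainSum X (i + 1) ⟶ F) ≃ (chainSum X i ⟶ (syz (Specialization X)).obj F) :=
  ((chainSumEquiv F (i + 1)).trans (evalSyzEquiv F i).symm).trans
    (chainSumEquiv ((syz (Specialization X)).obj F) i).symm

theorem evalSyz_consEquiv (i : ℕ) (f : chainSum X (i + 1) ⟶ F) :
    evalSyz F i (chainSumEquiv _ i (consEquiv F i f)) = chainSumEquiv F (i + 1) f := by
  rw [consEquiv, Equiv.trans_apply, Equiv.apply_symm_apply, Equiv.trans_apply]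
  exact (evalSyzEquiv F i).apply_symm_apply _

/-- A point, as a chain. -/
def pointChain (x : Specialization X) : StrictChain X 0 :=
  ⟨fun _ => x, fun i j h => absurd h (by lia)⟩

variable (F) in
/-- The families of elements are the families indexed by chains of length zero, and are the
morphisms from the integers to the group of families. -/
def familyEquiv : (∀ c : StrictChain X 0, F.obj (c.1 0)) ≃
    (intGrp ⟶ (family (Specialization X)).obj F) where
  toFun a := AddCommGrpCat.ofHom (ofInt (A := Family F) fun x => a (pointChain x))
  invFun f c := (f.hom ⟨1⟩ : Family F) (c.1 0)
  left_inv a := by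
    ext c
    obtain ⟨x, rfl⟩ : ∃ x, c = pointChain x :=
      ⟨c.1 0, Subtype.ext (funext fun i => congrArg c.1 (Fin.eq_zero i))⟩
    exact one_zsmul (a (pointChain x))
  right_inv f := by
    ext n
    exact congr_fun (smul_apply_one f.hom n) _

omit [Finite X] [Fintype (Specialization X)] in
theorem familyEquiv_naturality (g : F ⟶ G) (a : ∀ c : StrictChain X 0, F.obj (c.1 0))
    (b : ∀ c : StrictChain X 0, G.obj (c.1 0)) (h : ∀ c, b c = (g.app _).hom (a c)) :
    familyEquiv G b = familyEquiv F a ≫ (family (Specialization X)).map g := by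
  ext n
  refine funext fun x : Specialization X => ?_
  exact (congrArg (n.down • ·) (h (pointChain x))).trans (map_zsmul (g.app _).hom n.down _).symm

variable (X) in
/-- The sums over chains corepresent the values of the iterated syzygies. -/
def corepresentation : (barData (Specialization X)).Corepresentation intGrp where
  D := chainSum X
  e {F} := ((chainSumEquiv F 0).trans (familyEquiv F)).trans
    (((barColim (Specialization X)).symm.app F).homToEquiv :
      (intGrp ⟶ (family (Specialization X)).obj F) ≃
        (intGrp ⟶ colim.obj ((bar (Specialization X)).obj F)))
  e_comp {F G} f g := by
    have h : familyEquiv G (chainSumEquiv G 0 (f ≫ g)) =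
        familyEquiv F (chainSumEquiv F 0 f) ≫ (family (Specialization X)).map g :=
      familyEquiv_naturality g _ _ fun c => chainSumEquiv_comp f g c
    refine (congrArg (· ≫ (barColim (Specialization X)).inv.app G) h).trans ?_
    refine (Category.assoc _ _ _).trans (Eq.trans ?_ (Category.assoc _ _ _).symm)
    exact congrArg (_ ≫ ·) ((barColim (Specialization X)).inv.naturality g)
  κ i {F} := (consEquiv F i :
    (chainSum X (i + 1) ⟶ F) ≃ (chainSum X i ⟶ (syz (Specialization X)).obj F))
  κ_comp i {F G} f g := by
    apply ((chainSumEquiv ((syz (Specialization X)).obj G) i).trans (evalSyzEquiv G i)).injective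
    refine (evalSyz_consEquiv i (f ≫ g)).trans (funext fun c => ?_)
    refine (chainSumEquiv_comp f g c).trans ?_
    rw [← evalSyz_consEquiv]
    exact congr_fun (congrArg Subtype.val (chainSumEquiv_comp (consEquiv F i f)
      ((syz (Specialization X)).map g) (StrictChain.tail c))) (c.1 0) |>.symm

end

end FiniteSpace

/-! ### Finiteness, and identification of the codualizing complex -/

namespace FiniteSpace

open FinitePoset

/-- Homology is a quotient of a subgroup of the middle term, and $\mathbb Z$ is noetherian. -/
theorem finite_homology (S : ShortComplex AddCommGrpCat.{u}) [Module.Finite ℤ S.X₂] :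
    Module.Finite ℤ S.homology := by
  have h₁ : Function.Injective S.iCycles.hom := (AddCommGrpCat.mono_iff_injective _).1 inferInstance
  have h₂ : Function.Surjective S.homologyπ.hom :=
    (AddCommGrpCat.epi_iff_surjective _).1 inferInstance
  have : Module.Finite ℤ S.cycles := Module.Finite.of_injective S.iCycles.hom.toIntLinearMap h₁
  exact Module.Finite.of_surjective S.homologyπ.hom.toIntLinearMap h₂

theorem finite_of_iso {A B : AddCommGrpCat.{u}} (e : A ≅ B) [Module.Finite ℤ A] :
    Module.Finite ℤ B :=
  Module.Finite.of_surjective e.hom.hom.toIntLinearMap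
    ((AddCommGrpCat.epi_iff_surjective e.hom).1 inferInstance)

section

variable {X : Type u} [TopologicalSpace X]

theorem finite_supportOn (U : Opens X) (x : Specialization X) :
    Module.Finite ℤ ((supportOn (constInt X) U).obj x) :=
  let φ : ULift.{u} ℤ →+ ℤ := ⟨⟨ULift.down, rfl⟩, fun _ _ => rfl⟩
  Module.Finite.of_injective (N := ℤ)
    (φ.comp (supportedSubgroup (constInt X) U x).subtype).toIntLinearMap
    fun _ _ h => Subtype.ext (ULift.down_injective h)

variable [Finite X]

instance (i : ℕ) : Finite (StrictChain X i) :=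
  have : Finite (Specialization X) := ‹Finite X›
  inferInstance

instance : HasFiniteBiproducts (AbData X) := Abelian.hasFiniteBiproducts

omit [Finite X] in
theorem finite_biproduct {ι : Type u} [Finite ι] (f : ι → AbData X) (x : Specialization X)
    [∀ c, Module.Finite ℤ ((f c).obj x)] : Module.Finite ℤ ((⨁ f).obj x) := by
  have := Fintype.ofFinite ι
  refine Module.Finite.of_surjective (M := ∀ c, (f c).obj x)
    (∑ c, ((biproduct.ι f c).app x).hom.toIntLinearMap ∘ₗ LinearMap.proj c) fun a => ?_
  refine ⟨fun c => ((biproduct.π f c).app x).hom a, ?_⟩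
  have total : ∑ c, biproduct.π f c ≫ biproduct.ι f c = 𝟙 (⨁ f) := by
    classical
    refine biproduct.hom_ext' _ _ fun c => ?_
    simp [Preadditive.comp_sum, biproduct.ι_π_assoc, dite_comp]
  let φ : (⨁ f ⟶ ⨁ f) →+ (⨁ f).obj x :=
    { toFun g := (g.app x).hom a
      map_zero' := rfl
      map_add' _ _ := rfl }
  have h := congrArg φ total
  rw [map_sum] at h
  refine Eq.trans ?_ h
  rw [LinearMap.sum_apply]
  rfl

theorem finite_chainSum (i : ℕ) (x : Specialization X) : Module.Finite ℤ ((chainSum X i).obj x) :=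
  have := fun c : StrictChain X i =>
    finite_supportOn (minOpen (Specialization.ofEquiv (c.1 0))) x
  have := finite_biproduct (fun c : StrictChain X i =>
    supportOn (constInt X) (minOpen (Specialization.ofEquiv (c.1 0)))) x
  finite_of_iso (A := (⨁ fun c : StrictChain X i =>
    supportOn (constInt X) (minOpen (Specialization.ofEquiv (c.1 0)))).obj x) ((biproduct.isoCoproduct _).app x)

/-- The sum is empty, as a chain in its index set would be longer than the dimension. For empty `X`
the dimension is `⊥`, and degree `0` is included. -/
theorem isZero_chainSum {i : ℕ} (hi : dim X < i) : IsZero (chainSum X i) := by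
  rw [IsZero.iff_id_eq_zero]
  refine Limits.Sigma.hom_ext _ _ fun c => ?_
  exact absurd (Order.LTSeries.length_le_krullDim (LTSeries.mk i c.1 c.2)) hi.not_ge

variable [HasDerivedCategory.{u + 1} (AbData X)]

-- Evaluation at a point is exact, so the stalk of the homology is the homology of the complex of
-- stalks.
omit [Finite X] in
theorem isFiniteType_Q (K : CochainComplex (AbData X) ℤ)
    (hK : ∀ i x, Module.Finite ℤ ((K.X i).obj x)) : IsFiniteType (DerivedCategory.Q.obj K) := by
  intro i x
  rw [← Module.Finite.iff_addGroup_fg]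
  have := hK i x
  have h : Module.Finite ℤ ((K.sc i).map ((evaluation (Specialization X) AddCommGrpCat.{u}).obj x)).homology :=
    @finite_homology _ this
  have e : ((K.sc i).map ((evaluation (Specialization X) AddCommGrpCat.{u}).obj x)).homology ≅
    ((DerivedCategory.homologyFunctor (AbData X) i).obj (DerivedCategory.Q.obj K)).obj x :=
    (K.sc i).mapHomologyIso ((evaluation (Specialization X) AddCommGrpCat.{u}).obj x) ≪≫
     ((DerivedCategory.homologyFunctorFactors (AbData X) i).symm.app K).app x
  exact finite_of_iso e

omit [Finite X] in
theorem IsFiniteType.of_iso {D E : DerivedCategory (AbData X)} (e : D ≅ E) (h : IsFiniteType D) :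
    IsFiniteType E := by
  intro i x
  have := Module.Finite.iff_addGroup_fg.2 (h i x)
  exact Module.Finite.iff_addGroup_fg.1
    (finite_of_iso (((DerivedCategory.homologyFunctor (AbData X) i).mapIso e).app x))

variable [T0Space X] [HasDerivedCategory.{u + 1} AddCommGrpCat.{u}] [Fintype (Specialization X)]

omit [Finite X] in
variable (X) in
theorem exists_counit :
    ∃ α : DerivedCategory.Q ⋙ (barData (Specialization X)).derived vanishes ⟶
      cosectionsToDerived X, ((barData (Specialization X)).derived vanishes).IsLeftDerivedFunctor α
        (HomologicalComplex.quasiIso (AbData X) (ComplexShape.up ℤ)) :=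
  ⟨_, (barData (Specialization X)).isLeftDerivedFunctor_derived vanishes⟩

omit [Finite X] in
theorem hasDerivedCosections : HasDerivedCosections X :=
  have ⟨α, _⟩ := exists_counit X
  Functor.HasLeftDerivedFunctor.mk' ((barData (Specialization X)).derived vanishes) α

/-- The left derived functor of the cosections is induced by the iterated resolutions. -/
def derivedCosectionsIso [HasDerivedCosections X] :
    (barData (Specialization X)).derived vanishes ≅ derivedCosections X :=
  have := (exists_counit X).choose_spec
  Functor.leftDerivedUnique ((cosectionsToDerived X).totalLeftDerived DerivedCategory.Q
    (HomologicalComplex.quasiIso (AbData X) (ComplexShape.up ℤ)))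
    ((barData (Specialization X)).derived vanishes) (exists_counit X).choose
    ((cosectionsToDerived X).totalLeftDerivedCounit DerivedCategory.Q _)
    (HomologicalComplex.quasiIso (AbData X) (ComplexShape.up ℤ))

variable (X) in
/-- The complex of the sums over chains. -/
abbrev chainComplex : CochainComplex (AbData X) ℤ := (corepresentation X).complex

theorem isCodualizing_Q_chainComplex [HasDerivedCosections X] :
    IsCodualizing X (DerivedCategory.Q.obj (chainComplex X)) :=
  ⟨((corepresentation X).corepresentableBy vanishes).ofIso
    (Functor.isoWhiskerRight derivedCosectionsIso _)⟩

omit [HasDerivedCategory (AbData X)] [HasDerivedCategory AddCommGrpCat] in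
theorem finite_chainComplex (i : ℤ) (x : Specialization X) :
    Module.Finite ℤ (((chainComplex X).X i).obj x) := by
  obtain (i | i) := i
  · exact finite_chainSum i x
  · have h := (Functor.isZero_iff _).1 ((corepresentation X).isZero_cX _ (Int.negSucc_lt_zero i)) x
    have := AddCommGrpCat.subsingleton_of_isZero h
    exact inferInstanceAs (Module.Finite ℤ (((corepresentation X).cX (.negSucc i)).obj x))

end

end FiniteSpace

end

theorem mainTheorem8 (X : Type u) [TopologicalSpace X] [Finite X] [T0Space X]
    [HasDerivedCategory.{u + 1} (FiniteSpace.AbData X)]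
    [HasDerivedCategory.{u + 1} AddCommGrpCat.{u}] :
    ∃ _ : FiniteSpace.HasDerivedCosections X,
      ∃ K : CochainComplex (FiniteSpace.AbData X) ℤ,
        (∀ i : ℕ, Nonempty (K.X i ≅ FiniteSpace.chainSum X i)) ∧
        (∀ i : ℤ, i < 0 → IsZero (K.X i)) ∧
        (∀ i : ℕ, FiniteSpace.dim X < i → IsZero (K.X i)) ∧
        FiniteSpace.IsCodualizing X (DerivedCategory.Q.obj K) ∧
        ∀ D : DerivedCategory (FiniteSpace.AbData X), FiniteSpace.IsCodualizing X D →
          Nonempty (D ≅ DerivedCategory.Q.obj K) ∧ FiniteSpace.IsFiniteType D := by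
  have : Finite (Specialization X) := ‹Finite X›
  have := Fintype.ofFinite (Specialization X)
  have h := FiniteSpace.hasDerivedCosections (X := X)
  refine ⟨h, FiniteSpace.chainComplex X, fun i => ⟨Iso.refl _⟩,
    (FiniteSpace.corepresentation X).isZero_cX, fun i hi => FiniteSpace.isZero_chainSum hi,
    FiniteSpace.isCodualizing_Q_chainComplex, fun D ⟨hD⟩ => ?_⟩
  obtain ⟨hK⟩ := FiniteSpace.isCodualizing_Q_chainComplex (X := X)
  let e := hD.uniqueUpToIso hK
  exact ⟨⟨e⟩, (FiniteSpace.isFiniteType_Q _ FiniteSpace.finite_chainComplex).of_iso e.symm⟩
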